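/- Let $R=\bigoplus_{n\ge 0}R_n=R_0[R_1]$ be a standard graded (commutative) Noetherian ring of dimension $d\ge 2$ such that $R_0$ is an Artinian local ring with maximal ideal $\mathfrak m$, and suppose that $\mathfrak p=\mathfrak mR$ is a prime ideal of $R$. For a finitely generated ($\mathbb Z$-)graded $R$-module $N=\bigoplus_{n\in\mathbb Z}N_n$ of dimension $s$, the Hilbert coefficients of $N$ are the unique integers $\mathrm e_0(N),\dots,\mathrm e_{s-1}(N)$ such that $$\ell_{R_0}(N_n)=\sum_{i=0}^{s-1}(-1)^i\,\mathrm e_i(N)\binom{n+s-1-i}{s-1-i}\qquad\text{for all } n\gg 0,$$ where $\ell$ denotes length. For $k\in\mathbb Z$, $N(k)$ denotes the shifted module with $N(k)_n=N_{n+k}$. Let $M$ be a finitely generated graded $R$-module generated in the single degree $t\in\mathbb Z$, i.e. $M=RM_t$. Suppose that $\dim_R M=d$ and $\operatorname{Ass}_R M=\operatorname{Min}_R M$. Then the following hold (where $R/\mathfrak p$ has dimension $d$ and $\ell_{R_{\mathfrak p}}(M_{\mathfrak p})<\infty$). (a) $\mathrm e_0(M)=\ell_{R_{\mathfrak p}}(M_{\mathfrak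 p})\cdot \mathrm e_0(R/\mathfrak p)$ and $\mathrm e_1(M)\le t\,\mathrm e_0(M)+\ell_{R_{\mathfrak p}}(M_{\mathfrak p})\cdot \mathrm e_1(R/\mathfrak p)$. (b) Consider the following conditions: (i) $\mathrm e_1(M)= t\,\mathrm e_0(M)+\ell_{R_{\mathfrak p}}(M_{\mathfrak p})\cdot \mathrm e_1(R/\mathfrak p)$. (ii) There exist an integer $i_0\ge 0$ and a family $\{M^i\}_{0\le i\le i_0}$ of graded residue modules (quotients by graded submodules) of $M$ with $M^0=M$ and $M^{i_0}=0$, together with exact sequences of graded $R$-modules and degree-preserving maps $$0\to (R/\mathfrak p)(-t)\to M^i\to M^{i+1}\to 0\qquad\text{for all } 0\le i\le i_0-1 .$$ Then (ii) $\Rightarrow$ (i) holds. If $R/\mathfrak p$ satisfies Serre's condition $(S_2)$, i.e. $\operatorname{depth}\,(R/\mathfrak p)_{\mathfrak q}\ge\min\{2,\dim (R/\mathfrak p)_{\mathfrak q}\}$ for all primes $\mathfrak q$ of $R/\mathfrak p$, then (i) $\Rightarrow$ (ii) also holds. -/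

import Mathlib

/-- The `n`-th homogeneous component `R_n` of an `ℕ`-graded ring, as an `R_0`-submodule of `R`. -/
def ringPiece {R : Type*} [CommRing R] (𝒜 : ℕ → AddSubgroup R) [GradedRing 𝒜] (n : ℕ) :
    Submodule (𝒜 0) R where
  carrier := 𝒜 n
  add_mem' := (𝒜 n).add_mem
  zero_mem' := (𝒜 n).zero_mem
  smul_mem' a x hx := by
    have h := SetLike.GradedMul.mul_mem (A := 𝒜) a.2 hx
    rw [zero_add] at h
    exact h

/-- The `ℕ`-graded ring `R` viewed as a `ℤ`-graded module over itself: `R_n = 0` for `n < 0`. -/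
def ringGrading {R : Type*} [CommRing R] (𝒜 : ℕ → AddSubgroup R) [GradedRing 𝒜] :
    ℤ → Submodule (𝒜 0) R
  | Int.ofNat n => ringPiece 𝒜 n
  | Int.negSucc _ => ⊥

section GradedModules

variable {A R M N : Type*} [CommRing A] [CommRing R] [Algebra A R]
  [AddCommGroup M] [Module A M] [Module R M] [IsScalarTower A R M]
  [AddCommGroup N] [Module A N] [Module R N] [IsScalarTower A R N]

/-- The grading of the residue module `M / L`: its degree `n` part is the image of `M_n`. -/
def quotGrading (ℳ : ℤ → Submodule A M) (L : Submodule R M) : ℤ → Submodule A (M ⧸ L) :=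
  fun n => (ℳ n).map (L.mkQ.restrictScalars A)

/-- The grading of the shifted module `M(k)`: `M(k)_n = M_{n + k}`. -/
def shiftGrading (ℳ : ℤ → Submodule A M) (k : ℤ) : ℤ → Submodule A M :=
  fun n => ℳ (n + k)

/-- An `R`-linear map that preserves degrees. -/
def IsGradedHom (ℳ : ℤ → Submodule A M) (𝒩 : ℤ → Submodule A N) (f : M →ₗ[R] N) : Prop :=
  ∀ n : ℤ, ∀ x ∈ ℳ n, f x ∈ 𝒩 n

variable (R) in
/-- `M` has dimension `s` over `R`, and `e 0, …, e (s - 1)` are its Hilbert coefficients: for all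
large `n` the length of the `A`-module `M_n` is finite and equal to
`∑ i < s, (-1)^i * e i * (n + s - 1 - i).choose (s - 1 - i)`. -/
def IsHilbertCoeffs (ℳ : ℤ → Submodule A M) {s : ℕ} (e : Fin s → ℤ) : Prop :=
  Module.supportDim R M = (s : WithBot ℕ∞) ∧
  ∀ᶠ n : ℕ in Filter.atTop, ∃ l : ℕ, Module.length A (ℳ (n : ℤ)) = (l : ℕ∞) ∧
    (l : ℤ) = ∑ i : Fin s,
      (-1) ^ (i : ℕ) * e i * ((n + (s - 1 - (i : ℕ))).choose (s - 1 - (i : ℕ)) : ℤ)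

/-- For a graded `R`-module `M`, a graded module `K` and an integer `t`: there are graded residue
modules `M^i = M / L i` of `M`, with `M^0 = M` and `M^{i₀} = 0`, and exact sequences
`0 → K(-t) → M^i → M^{i+1} → 0` of graded modules for all `i < i₀`. -/
def HasShiftFiltration (ℳ : ℤ → Submodule A M) [DirectSum.Decomposition ℳ]
    (𝒦 : ℤ → Submodule A N) (t : ℤ) : Prop :=
  ∃ (i₀ : ℕ) (L : ℕ → Submodule R M),
    (∀ i ≤ i₀, (L i).IsHomogeneous ℳ) ∧ L 0 = ⊥ ∧ L i₀ = ⊤ ∧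
    ∀ i < i₀, ∃ (f : N →ₗ[R] M ⧸ L i) (g : (M ⧸ L i) →ₗ[R] M ⧸ L (i + 1)),
      IsGradedHom (shiftGrading 𝒦 (-t)) (quotGrading ℳ (L i)) f ∧
      IsGradedHom (quotGrading ℳ (L i)) (quotGrading ℳ (L (i + 1))) g ∧
      Function.Injective f ∧ Function.Exact f g ∧ Function.Surjective g

end GradedModules

/-- The depth of a local ring: the supremum of the lengths of regular sequences in its maximal
ideal. -/
noncomputable def localDepth (S : Type*) [CommRing S] [IsLocalRing S] : ℕ∞ :=
  ⨆ (rs : List S) (_ : (∀ r ∈ rs, r ∈ IsLocalRing.maximalIdeal S) ∧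
    RingTheory.Sequence.IsRegular S rs), (rs.length : ℕ∞)

/-- Serre's condition `(S_k)`: `depth S_𝔮 ≥ min {k, dim S_𝔮}` for all primes `𝔮` of `S`. -/
def SerreCondition (S : Type*) [CommRing S] (k : ℕ) : Prop :=
  ∀ (𝔮 : Ideal S) [𝔮.IsPrime],
    min (k : WithBot ℕ∞) (ringKrullDim (Localization.AtPrime 𝔮)) ≤
      (localDepth (Localization.AtPrime 𝔮) : WithBot ℕ∞)

/-!
The ideal `𝔭 = 𝔪R` is nil, because `R₀` is Artinian local; being prime, it is the only minimal prime
of `R`, and `dim R / 𝔭 = d`. As `M` has dimension `d` and no embedded primes, `M` is torsion-free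
over `R ∖ 𝔭` (`isSaturatedAt_bot`).

Starting from `L₀ = 0`, choose `xᵢ ∈ M_t` with `(Lᵢ : xᵢ) = 𝔭`, which is possible since `M` is
generated in degree `t` and `𝔭` is generated by nilpotents of degree zero, and let `Lᵢ₊₁` be the
saturation of `Lᵢ + R xᵢ` with respect to `𝔭`. This is a finite chain of homogeneous submodules from
`0` to `M` (`exists_saturated_chain`). Localized at `𝔭` it is a composition series, so the number of
its steps is the length `l` of `M_𝔭` (`length_localizedModule_eq`). Its factors are extensions of
torsion `R / 𝔭`-modules `Tᵢ = Lᵢ₊₁ / (Lᵢ + R xᵢ)` by `(R / 𝔭)(-t)`, whence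
`H_M(n) = l h(n - t) + ∑ τᵢ(n)`, with `h` and `τᵢ` the Hilbert functions of `R / 𝔭` and of `Tᵢ`.

Since `dim Tᵢ < d`, the function `τᵢ` is eventually a polynomial of degree at most `d - 2`
(`isNumPoly_quotHilb_sub_saturationAt`), whose coefficient `cᵢ` in degree `d - 2`, normalized by
taking the difference `d - 2` times, is nonnegative. Comparing leading coefficients
(`leading_coeffs_eq`) yields `e₀(M) = l e₀(R / 𝔭)` and
`e₁(M) = t e₀(M) + l e₁(R / 𝔭) - ∑ cᵢ`, hence (a).

A filtration as in (ii) gives `H_M(n) = r h(n - t)` for its number `r` of steps, and `r = l` by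
comparison of `e₀`, as `e₀(R / 𝔭) ≠ 0`; this is (i). Conversely (i) forces all `cᵢ = 0`. If `R / 𝔭`
satisfies `(S₂)` and `Tᵢ ≠ 0`, an associated prime `𝔮` of `Tᵢ` has height one modulo `𝔭`
(`height_map_lt_two_of_colonElem`), so `R / 𝔮` has dimension `d - 1` and its Hilbert function, a
lower bound for a shift of `τᵢ`, has degree `d - 2` (`not_quotHilb_le_of_height_lt_two`),
contradicting `cᵢ = 0`. So all `Tᵢ` vanish (`saturationAt_sup_span_eq`), and the chain is the
filtration required in (ii).

The Hilbert–Serre theorem is proved by dévissage along homogeneous primes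
(`isNumPoly_quotHilb_of_ringKrullDim_le`). The lower bounds for Hilbert functions come from
polynomial rings inside the residue rings: Noether normalization for `R / 𝔭`, and in addition going
down for the primes of height one (`exists_mvPolynomial_injective_of_height_le_one`).
-/

open Filter DirectSum

/-! ### Numerical functions that are eventually polynomial -/

/-- The backward difference operator `f ↦ (n ↦ f n - f (n - 1))` on functions `ℤ → ℤ`. -/
def bwdDiff : Module.End ℤ (ℤ → ℤ) where
  toFun f n := f n - f (n - 1)
  map_add' f g := by
    funext n
    simp only [Pi.add_apply]
    ring
  map_smul' c f := by
    funext n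
    simp only [Pi.smul_apply, smul_eq_mul, RingHom.id_apply]
    ring

theorem bwdDiff_apply (f : ℤ → ℤ) (n : ℤ) : bwdDiff f n = f n - f (n - 1) := rfl

theorem bwdDiff_pow_succ (s : ℕ) (f : ℤ → ℤ) :
    (bwdDiff ^ (s + 1)) f = (bwdDiff ^ s) (bwdDiff f) := by
  rw [pow_succ, Module.End.mul_apply]

theorem bwdDiff_pow_succ' (s : ℕ) (f : ℤ → ℤ) :
    (bwdDiff ^ (s + 1)) f = bwdDiff ((bwdDiff ^ s) f) := by
  rw [pow_succ', Module.End.mul_apply]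

theorem tendsto_sub_const_atTop (a : ℤ) : Tendsto (fun n : ℤ => n - a) atTop atTop :=
  tendsto_atTop_add_const_right _ (-a) tendsto_id

theorem bwdDiff_congr {f g : ℤ → ℤ} (h : f =ᶠ[atTop] g) : bwdDiff f =ᶠ[atTop] bwdDiff g := by
  filter_upwards [h, (tendsto_sub_const_atTop 1).eventually h] with n h1 h2
  rw [bwdDiff_apply, bwdDiff_apply, h1, h2]

theorem bwdDiff_pow_congr (s : ℕ) {f g : ℤ → ℤ} (h : f =ᶠ[atTop] g) :
    (bwdDiff ^ s) f =ᶠ[atTop] (bwdDiff ^ s) g := by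
  induction s with
  | zero => simpa using h
  | succ s ih =>
    rw [bwdDiff_pow_succ', bwdDiff_pow_succ']
    exact bwdDiff_congr ih

theorem bwdDiff_pow_shift (s : ℕ) (f : ℤ → ℤ) (a : ℤ) :
    (bwdDiff ^ s) (fun n => f (n - a)) = fun n => (bwdDiff ^ s) f (n - a) := by
  induction s with
  | zero => simp
  | succ s ih =>
    rw [bwdDiff_pow_succ', bwdDiff_pow_succ', ih]
    funext n
    rw [bwdDiff_apply, bwdDiff_apply, sub_right_comm]

/-- `f` agrees for large arguments with a polynomial function of degree less than `s`; encoded by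
the vanishing of the `s`-th difference of `f` for large arguments. -/
def IsNumPoly (s : ℕ) (f : ℤ → ℤ) : Prop :=
  ∀ᶠ n in atTop, (bwdDiff ^ s) f n = 0

theorem isNumPoly_zero_iff {f : ℤ → ℤ} : IsNumPoly 0 f ↔ ∀ᶠ n in atTop, f n = 0 := by
  simp [IsNumPoly]

theorem isNumPoly_succ_iff {s : ℕ} {f : ℤ → ℤ} :
    IsNumPoly (s + 1) f ↔ IsNumPoly s (bwdDiff f) := by
  rw [IsNumPoly, IsNumPoly, bwdDiff_pow_succ]

theorem IsNumPoly.congr {s : ℕ} {f g : ℤ → ℤ} (hf : IsNumPoly s f) (h : f =ᶠ[atTop] g) :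
    IsNumPoly s g := by
  filter_upwards [hf, bwdDiff_pow_congr s h] with n h1 h2
  rw [← h2, h1]

theorem IsNumPoly.zero (s : ℕ) : IsNumPoly s 0 := by
  simp [IsNumPoly]

theorem IsNumPoly.add {s : ℕ} {f g : ℤ → ℤ} (hf : IsNumPoly s f) (hg : IsNumPoly s g) :
    IsNumPoly s (f + g) := by
  filter_upwards [hf, hg] with n h1 h2
  rw [map_add, Pi.add_apply, h1, h2, add_zero]

theorem IsNumPoly.shift {s : ℕ} {f : ℤ → ℤ} (hf : IsNumPoly s f) (a : ℤ) :
    IsNumPoly s (fun n => f (n - a)) := by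
  rw [IsNumPoly, bwdDiff_pow_shift]
  exact (tendsto_sub_const_atTop a).eventually hf

theorem IsNumPoly.succ {s : ℕ} {f : ℤ → ℤ} (hf : IsNumPoly s f) : IsNumPoly (s + 1) f := by
  have := bwdDiff_congr (g := 0) hf
  rw [map_zero] at this
  rw [IsNumPoly, bwdDiff_pow_succ']
  exact this

theorem IsNumPoly.mono {s s' : ℕ} (h : s ≤ s') {f : ℤ → ℤ} (hf : IsNumPoly s f) :
    IsNumPoly s' f := by
  induction s', h using Nat.le_induction with
  | base => exact hf
  | succ s' _ ih => exact ih.succ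

theorem exists_eventually_eq_const {f : ℤ → ℤ} (h : ∀ᶠ n in atTop, bwdDiff f n = 0) :
    ∃ c, ∀ᶠ n in atTop, f n = c := by
  obtain ⟨N, hN⟩ := eventually_atTop.1 h
  refine ⟨f N, eventually_atTop.2 ⟨N, fun n hn => ?_⟩⟩
  induction n, hn using Int.leInduction with
  | base => rfl
  | succ n hn ih =>
    have := hN (n + 1) (by omega)
    rw [bwdDiff_apply, add_sub_cancel_right] at this
    omega

/-- The binomial function `n ↦ (n + i).choose i`, continued to negative `n` by a constant. -/
def binomFun (i : ℕ) (n : ℤ) : ℤ := ((n.toNat + i).choose i : ℤ)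

theorem binomFun_natCast (i n : ℕ) : binomFun i n = ((n + i).choose i : ℤ) := rfl

theorem binomFun_zero (n : ℤ) : binomFun 0 n = 1 := by simp [binomFun]

theorem bwdDiff_binomFun_zero : bwdDiff (binomFun 0) = 0 := by
  funext n
  simp [bwdDiff_apply, binomFun_zero]

theorem bwdDiff_binomFun_succ (i : ℕ) : bwdDiff (binomFun (i + 1)) =ᶠ[atTop] binomFun i := by
  filter_upwards [eventually_ge_atTop 1] with n hn
  obtain ⟨m, rfl⟩ : ∃ m : ℕ, n = m + 1 := ⟨(n - 1).toNat, by omega⟩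
  rw [bwdDiff_apply, add_sub_cancel_right, ← Nat.cast_succ, binomFun_natCast, binomFun_natCast,
    binomFun_natCast]
  have := Nat.choose_succ_succ (m + 1 + i) i
  rw [show m + 1 + (i + 1) = (m + 1 + i) + 1 by ring, show m + (i + 1) = m + 1 + i by ring]
  simp only [Nat.succ_eq_add_one] at this ⊢
  rw [this]
  push_cast
  ring

theorem bwdDiff_sum_binomFun (s : ℕ) (c : ℕ → ℤ) :
    bwdDiff (∑ i ∈ Finset.range (s + 1), c i • binomFun i) =ᶠ[atTop]
      ∑ i ∈ Finset.range s, c (i + 1) • binomFun i := by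
  rw [Finset.sum_range_succ', map_add, map_sum, map_smul, bwdDiff_binomFun_zero, smul_zero,
    add_zero]
  have : ∀ᶠ n in atTop, ∀ i ∈ Finset.range s, bwdDiff (binomFun (i + 1)) n = binomFun i n :=
    (eventually_all_finset _).2 fun i _ => bwdDiff_binomFun_succ i
  filter_upwards [this] with n hn
  simp only [Finset.sum_apply, map_smul, Pi.smul_apply]
  exact Finset.sum_congr rfl fun i hi => by rw [hn i hi]

theorem IsNumPoly.exists_binomFun {s : ℕ} {f : ℤ → ℤ} (hf : IsNumPoly s f) :
    ∃ c : ℕ → ℤ, f =ᶠ[atTop] ∑ i ∈ Finset.range s, c i • binomFun i := by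
  induction s generalizing f with
  | zero =>
    refine ⟨0, ?_⟩
    rw [Finset.sum_range_zero]
    exact isNumPoly_zero_iff.1 hf
  | succ s ih =>
    obtain ⟨c, hc⟩ := ih (isNumPoly_succ_iff.1 hf)
    let c' : ℕ → ℤ := fun i => if i = 0 then 0 else c (i - 1)
    have h1 := bwdDiff_sum_binomFun s c'
    have h2 : ∀ᶠ n in atTop,
        bwdDiff (f - ∑ i ∈ Finset.range (s + 1), c' i • binomFun i) n = 0 := by
      filter_upwards [hc, h1] with n h2 h3
      rw [map_sub, Pi.sub_apply, h2, h3]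
      simp [c']
    obtain ⟨a, ha⟩ := exists_eventually_eq_const h2
    refine ⟨fun i => if i = 0 then a else c (i - 1), ?_⟩
    filter_upwards [ha] with n hn
    rw [Pi.sub_apply, sub_eq_iff_eq_add] at hn
    -- `f` differs from an antidifference of its difference by the constant `a`.
    rw [hn, Finset.sum_range_succ', Finset.sum_range_succ']
    simp [c', binomFun_zero, add_comm]

theorem eq_zero_of_sum_binomFun_eventually_eq_zero {s : ℕ} {c : ℕ → ℤ}
    (h : ∑ i ∈ Finset.range s, c i • binomFun i =ᶠ[atTop] 0) : ∀ i < s, c i = 0 := by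
  induction s generalizing c with
  | zero => simp
  | succ s ih =>
    have h1 : ∑ i ∈ Finset.range s, c (i + 1) • binomFun i =ᶠ[atTop] 0 := by
      filter_upwards [bwdDiff_sum_binomFun s c, bwdDiff_congr h] with n h1 h2
      rw [← h1, h2]
      simp
    have h2 := ih h1
    have h3 : ∀ i ∈ Finset.range s, c (i + 1) • binomFun (i + 1) = 0 := fun i hi => by
      rw [h2 i (Finset.mem_range.1 hi), zero_smul]
    rw [Finset.sum_range_succ', Finset.sum_eq_zero h3, zero_add] at h
    obtain ⟨n, hn⟩ := h.exists
    intro i hi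
    cases i with
    | zero => simpa [binomFun_zero] using hn
    | succ i => exact h2 i (by omega)

theorem bwdDiff_pow_sum_binomFun (s r : ℕ) (c : ℕ → ℤ) :
    (bwdDiff ^ r) (∑ i ∈ Finset.range (s + r), c i • binomFun i) =ᶠ[atTop]
      ∑ i ∈ Finset.range s, c (i + r) • binomFun i := by
  induction r generalizing c with
  | zero => simp
  | succ r ih =>
    rw [bwdDiff_pow_succ, ← add_assoc]
    refine (bwdDiff_pow_congr r (bwdDiff_sum_binomFun (s + r) c)).trans ((ih _).trans ?_)
    simp only [add_assoc]
    rfl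

/-- The coefficients with respect to the functions `binomFun j` of the polynomial function with
Hilbert coefficients `e`. -/
def hilbertCoeffsRev {s : ℕ} (e : Fin s → ℤ) (j : ℕ) : ℤ :=
  if h : s - 1 - j < s then (-1) ^ (s - 1 - j) * e ⟨s - 1 - j, h⟩ else 0

theorem hilbertCoeffsRev_apply {s : ℕ} (e : Fin s → ℤ) (i : Fin s) :
    hilbertCoeffsRev e (s - 1 - i) = (-1) ^ (i : ℕ) * e i := by
  have h : s - 1 - (s - 1 - (i : ℕ)) = i := by have := i.2; omega
  rw [hilbertCoeffsRev, dif_pos (by have := i.2; omega)]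
  simp only [h]

theorem sum_hilbertCoeffs_eq {s : ℕ} {e : Fin s → ℤ} {c : ℕ → ℤ}
    (h : ∀ i : Fin s, c (s - 1 - i) = (-1) ^ (i : ℕ) * e i) (n : ℕ) :
    ∑ i : Fin s, (-1) ^ (i : ℕ) * e i *
      ((n + (s - 1 - (i : ℕ))).choose (s - 1 - (i : ℕ)) : ℤ) =
    (∑ j ∈ Finset.range s, c j • binomFun j) n := by
  rw [← Finset.sum_range_reflect, Finset.sum_range, Finset.sum_apply]
  refine Finset.sum_congr rfl fun i _ => ?_
  rw [Pi.smul_apply, binomFun_natCast, h, smul_eq_mul]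

theorem eventually_eq_sum_binomFun_iff {s : ℕ} {f : ℤ → ℤ} {e : Fin s → ℤ} {c : ℕ → ℤ}
    (h : ∀ i : Fin s, c (s - 1 - i) = (-1) ^ (i : ℕ) * e i) :
    (∀ᶠ n : ℕ in atTop, f n = ∑ i : Fin s, (-1) ^ (i : ℕ) * e i *
      ((n + (s - 1 - (i : ℕ))).choose (s - 1 - (i : ℕ)) : ℤ)) ↔
    f =ᶠ[atTop] ∑ j ∈ Finset.range s, c j • binomFun j := by
  rw [EventuallyEq, ← Nat.map_cast_int_atTop, eventually_map]
  simp only [sum_hilbertCoeffs_eq h]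

/-- The two leading coefficients `e₀`, `e₁` of a numerical polynomial of degree at most `r + 1` can
be read off from its `r`-th difference. -/
theorem bwdDiff_pow_eq_of_hilbertPoly {r : ℕ} {f : ℤ → ℤ} {e : Fin (r + 2) → ℤ}
    (h : ∀ᶠ n : ℕ in atTop, f n = ∑ i : Fin (r + 2), (-1) ^ (i : ℕ) * e i *
      ((n + (r + 2 - 1 - (i : ℕ))).choose (r + 2 - 1 - (i : ℕ)) : ℤ)) :
    ∀ᶠ n in atTop, (bwdDiff ^ r) f n = e 0 * (n + 1) - e 1 := by
  have h1 := (eventually_eq_sum_binomFun_iff (hilbertCoeffsRev_apply e)).1 h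
  rw [show Finset.range (r + 2) = Finset.range (2 + r) by rw [add_comm]] at h1
  filter_upwards [bwdDiff_pow_congr r h1, bwdDiff_pow_sum_binomFun 2 r (hilbertCoeffsRev e),
    eventually_ge_atTop 0] with n h2 h3 h4
  obtain ⟨m, rfl⟩ := Int.eq_ofNat_of_zero_le h4
  have h5 : hilbertCoeffsRev e r = -e 1 := by
    have := hilbertCoeffsRev_apply e 1
    simpa using this
  have h6 : hilbertCoeffsRev e (1 + r) = e 0 := by
    have := hilbertCoeffsRev_apply e 0
    simpa [add_comm 1 r] using this
  rw [h2, h3]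
  simp only [Finset.sum_range_succ, Finset.sum_range_zero, Pi.add_apply, Pi.smul_apply, h5, h6,
    binomFun_natCast, smul_eq_mul, zero_add]
  simp
  ring

/-- A numerical polynomial that is nonnegative for large arguments has nonnegative leading
coefficient. -/
theorem IsNumPoly.exists_nonneg_const {s : ℕ} {f : ℤ → ℤ} (hf : IsNumPoly (s + 1) f)
    (h0 : ∀ᶠ n in atTop, 0 ≤ f n) : ∃ c : ℤ, 0 ≤ c ∧ ∀ᶠ n in atTop, (bwdDiff ^ s) f n = c := by
  have step : ∀ g : ℤ → ℤ, (∀ᶠ n in atTop, bwdDiff g n ≤ -1) → ∀ᶠ n in atTop, g n ≤ -1 := by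
    intro g hg
    obtain ⟨N, hN⟩ := eventually_atTop.1 hg
    have key : ∀ n, N ≤ n → g n ≤ g N - (n - N) := by
      intro n hn
      induction n, hn using Int.leInduction with
      | base => simp
      | succ n hn ih =>
        have := hN (n + 1) (by omega)
        rw [bwdDiff_apply, add_sub_cancel_right] at this
        omega
    filter_upwards [eventually_ge_atTop N, eventually_ge_atTop (g N + N + 1)] with n h1 h2
    have := key n h1
    omega
  have main : ∀ (k : ℕ) (g : ℤ → ℤ), (∀ᶠ n in atTop, (bwdDiff ^ k) g n ≤ -1) →
      ∀ᶠ n in atTop, g n ≤ -1 := by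
    intro k
    induction k with
    | zero => intro g hg; simpa using hg
    | succ k ih =>
      intro g hg
      rw [bwdDiff_pow_succ'] at hg
      exact ih g (step _ hg)
  rw [IsNumPoly, bwdDiff_pow_succ'] at hf
  obtain ⟨c, hc⟩ := exists_eventually_eq_const hf
  refine ⟨c, ?_, hc⟩
  by_contra hneg
  have h1 := main s f (by filter_upwards [hc] with n hn; omega)
  obtain ⟨n, hn, hn'⟩ := (h1.and h0).exists
  omega

theorem IsNumPoly.exists_abs_le {s : ℕ} {f : ℤ → ℤ} (hf : IsNumPoly (s + 1) f) :
    ∃ C : ℤ, 0 ≤ C ∧ ∀ n : ℕ, |f n| ≤ C * (n + 1) ^ s := by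
  induction s generalizing f with
  | zero =>
    obtain ⟨c, hc⟩ := exists_eventually_eq_const (f := f) (by simpa [IsNumPoly] using hf)
    rw [← Nat.map_cast_int_atTop, eventually_map] at hc
    obtain ⟨N, hN⟩ := eventually_atTop.1 hc
    refine ⟨|c| + ∑ i ∈ Finset.range N, |f i|, by positivity, fun n => ?_⟩
    rw [pow_zero, mul_one]
    by_cases hn : N ≤ n
    · rw [hN n hn]
      linarith [Finset.sum_nonneg fun i (_ : i ∈ Finset.range N) => abs_nonneg (f i)]
    · have := Finset.single_le_sum (f := fun i : ℕ => |f i|) (fun i _ => abs_nonneg _)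
        (Finset.mem_range.2 (not_le.1 hn))
      linarith [abs_nonneg c]
  | succ s ih =>
    obtain ⟨C, hC, h⟩ := ih (isNumPoly_succ_iff.1 hf)
    refine ⟨|f 0| + C, by positivity, fun n => ?_⟩
    have key : ∀ n : ℕ, |f n| ≤ |f 0| + n * (C * (n + 1) ^ s) := by
      intro n
      induction n with
      | zero => simp
      | succ n ih =>
        have h1 := h (n + 1)
        rw [bwdDiff_apply] at h1
        have h2 : ((n + 1 : ℕ) : ℤ) - 1 = n := by push_cast; ring
        rw [h2] at h1
        have h3 : |f (n + 1 : ℕ)| ≤ |f n| + |f (n + 1 : ℕ) - f n| := by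
          have := abs_add_le (f n) (f (n + 1 : ℕ) - f n)
          rwa [add_sub_cancel] at this
        have h4 : C * ((n : ℤ) + 1) ^ s ≤ C * (((n + 1 : ℕ) : ℤ) + 1) ^ s := by
          gcongr
          omega
        have h5 : (n : ℤ) * (C * ((n : ℤ) + 1) ^ s) ≤ n * (C * (((n + 1 : ℕ) : ℤ) + 1) ^ s) := by
          gcongr
        have h6 : (((n + 1 : ℕ) : ℤ)) * (C * (((n + 1 : ℕ) : ℤ) + 1) ^ s) =
          n * (C * (((n + 1 : ℕ) : ℤ) + 1) ^ s) + C * (((n + 1 : ℕ) : ℤ) + 1) ^ s := by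
          push_cast
          ring
        linarith
    have h1 := key n
    have h2 : (n : ℤ) * (C * (n + 1) ^ s) ≤ C * (n + 1) ^ (s + 1) := by
      rw [pow_succ]
      have : (0 : ℤ) ≤ C * (n + 1) ^ s := by positivity
      nlinarith
    have h3 : |f 0| ≤ |f 0| * ((n : ℤ) + 1) ^ (s + 1) :=
      le_mul_of_one_le_right (abs_nonneg _) (one_le_pow₀ (by omega))
    linarith [add_mul |f 0| C (((n : ℤ) + 1) ^ (s + 1))]

/-! ### Graded modules and homogeneous submodules -/

section Components

variable {A M N : Type*} [CommRing A] [AddCommGroup M] [Module A M] [AddCommGroup N] [Module A N]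

/-- The projection of a graded module onto its component of degree `n`, as an endomorphism. -/
def homComp (ℳ : ℤ → Submodule A M) [Decomposition ℳ] (n : ℤ) : M →ₗ[A] M where
  toFun x := decompose ℳ x n
  map_add' x y := by simp
  map_smul' a x := by
    rw [decompose_smul]
    rfl

variable (ℳ : ℤ → Submodule A M) [Decomposition ℳ]

theorem homComp_apply (n : ℤ) (x : M) : homComp ℳ n x = decompose ℳ x n := rfl

theorem homComp_mem (n : ℤ) (x : M) : homComp ℳ n x ∈ ℳ n := (decompose ℳ x n).2

variable {ℳ} in
theorem homComp_of_mem {n : ℤ} {x : M} (hx : x ∈ ℳ n) : homComp ℳ n x = x :=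
  decompose_of_mem_same ℳ hx

variable {ℳ} in
theorem homComp_of_mem_ne {m n : ℤ} {x : M} (hx : x ∈ ℳ m) (h : m ≠ n) : homComp ℳ n x = 0 :=
  decompose_of_mem_ne ℳ hx h

theorem exists_finset_sum_homComp (x : M) : ∃ S : Finset ℤ, ∑ n ∈ S, homComp ℳ n x = x := by
  classical
  exact ⟨_, sum_support_decompose ℳ x⟩

/-- A map that raises degrees by `a` commutes with taking homogeneous components. -/
theorem homComp_map (𝒩 : ℤ → Submodule A N) [Decomposition 𝒩] (f : M →+ N) (a : ℤ)
    (hf : ∀ n, ∀ x ∈ ℳ n, f x ∈ 𝒩 (n + a)) (n : ℤ) (x : M) :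
    homComp 𝒩 (n + a) (f x) = f (homComp ℳ n x) := by
  induction x using Decomposition.inductionOn ℳ with
  | zero => simp
  | @homogeneous i m =>
    by_cases h : i = n
    · subst h
      rw [homComp_of_mem (hf i m m.2), homComp_of_mem m.2]
    · rw [homComp_of_mem_ne (hf i m m.2) (by omega), homComp_of_mem_ne m.2 h, map_zero]
  | add x y hx hy => rw [map_add, map_add, map_add, map_add, hx, hy]

end Components

section Exact

variable {A K P Q : Type*} [CommRing A] [AddCommGroup K] [Module A K] [AddCommGroup P] [Module A P]
  [AddCommGroup Q] [Module A Q]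

/-- Lengths of homogeneous components are additive along an exact sequence `0 → K → P → Q → 0` of
graded modules, where `K → P` raises degrees by `a`. -/
theorem length_eq_add_of_graded_exact (𝒦 : ℤ → Submodule A K) [Decomposition 𝒦]
    (𝒢 : ℤ → Submodule A P) [Decomposition 𝒢] (ℋ : ℤ → Submodule A Q) [Decomposition ℋ]
    (f : K →ₗ[A] P) (g : P →ₗ[A] Q) (a : ℤ) (hf : ∀ n, ∀ x ∈ 𝒦 n, f x ∈ 𝒢 (n + a))
    (hg : ∀ n, ∀ x ∈ 𝒢 n, g x ∈ ℋ n) (hinj : Function.Injective f) (hexact : Function.Exact f g)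
    (hsurj : Function.Surjective g) (n : ℤ) :
    Module.length A (𝒢 (n + a)) = Module.length A (𝒦 n) + Module.length A (ℋ (n + a)) := by
  refine Module.length_eq_add_of_exact (f.restrict (hf n)) (g.restrict (hg (n + a))) ?_ ?_ ?_
  · intro x y hxy
    exact Subtype.ext (hinj (congrArg Subtype.val hxy))
  · intro y
    obtain ⟨x, hx⟩ := hsurj y
    refine ⟨⟨homComp 𝒢 (n + a) x, homComp_mem _ _ _⟩, Subtype.ext ?_⟩
    have h := homComp_map 𝒢 ℋ g.toAddMonoidHom 0 (fun n x hx => by simpa using hg n x hx) (n + a) x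
    rw [add_zero] at h
    simp only [LinearMap.toAddMonoidHom_coe] at h
    rw [hx, homComp_of_mem y.2] at h
    exact h.symm
  · intro y
    constructor
    · intro hy
      obtain ⟨x, hx⟩ := (hexact y).1 (congrArg Subtype.val hy)
      refine ⟨⟨homComp 𝒦 n x, homComp_mem _ _ _⟩, Subtype.ext ?_⟩
      have h := homComp_map 𝒦 𝒢 f.toAddMonoidHom a hf n x
      simp only [LinearMap.toAddMonoidHom_coe] at h
      rw [hx, homComp_of_mem y.2] at h
      exact h.symm
    · rintro ⟨x, rfl⟩
      exact Subtype.ext (hexact.apply_apply_eq_zero x)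

end Exact

section Quotients

variable {A R M : Type*} [CommRing A] [CommRing R] [Algebra A R] [AddCommGroup M] [Module A M]
  [Module R M] [IsScalarTower A R M]

omit [Algebra A R] [IsScalarTower A R M] in
theorem isHomogeneous_iff {ℳ : ℤ → Submodule A M} [Decomposition ℳ] {L : Submodule R M} :
    L.IsHomogeneous ℳ ↔ ∀ n, ∀ x ∈ L, homComp ℳ n x ∈ L :=
  Iff.rfl

variable (ℳ : ℤ → Submodule A M) [Decomposition ℳ]

omit [Decomposition ℳ] in
theorem mkQ_mem_quotGrading (L : Submodule R M) {n : ℤ} {x : M} (hx : x ∈ ℳ n) :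
    L.mkQ x ∈ quotGrading ℳ L n :=
  ⟨x, hx, rfl⟩

omit [Algebra A R] [IsScalarTower A R M] in
theorem mem_of_forall_homComp_mem {L : Submodule R M} {x : M} (h : ∀ n, homComp ℳ n x ∈ L) :
    x ∈ L := by
  obtain ⟨S, hS⟩ := exists_finset_sum_homComp ℳ x
  rw [← hS]
  exact sum_mem fun n _ => h n

variable {ℳ} in
/-- The residue module of a graded module by a homogeneous submodule is graded. -/
noncomputable abbrev quotDecomposition {L : Submodule R M} (hL : L.IsHomogeneous ℳ) :
    Decomposition (quotGrading ℳ L) := by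
  refine IsInternal.chooseDecomposition _
    ((isInternal_submodule_iff_iSupIndep_and_iSup_eq_top _).2 ⟨fun i => ?_, ?_⟩)
  · rw [Submodule.disjoint_def]
    rintro y ⟨x, hx, rfl⟩ hy
    simp only [quotGrading, ← Submodule.map_iSup] at hy
    obtain ⟨x', hx', h⟩ := hy
    have h0 : ⨆ j, ⨆ (_ : j ≠ i), ℳ j ≤ LinearMap.ker (homComp ℳ i) :=
      iSup₂_le fun j hj z hz => homComp_of_mem_ne hz hj
    have h1 : x' - x ∈ L := (Submodule.Quotient.eq L).1 h
    have h2 := isHomogeneous_iff.1 hL i _ h1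
    rw [map_sub, homComp_of_mem hx, LinearMap.mem_ker.1 (h0 hx'), zero_sub, neg_mem_iff] at h2
    exact (Submodule.Quotient.mk_eq_zero L).2 h2
  · rw [eq_top_iff]
    intro y _
    obtain ⟨x, rfl⟩ := L.mkQ_surjective y
    obtain ⟨S, hS⟩ := exists_finset_sum_homComp ℳ x
    rw [← hS, map_sum]
    exact sum_mem fun n _ =>
      Submodule.mem_iSup_of_mem n (mkQ_mem_quotGrading ℳ L (homComp_mem ℳ n x))

/-- The Hilbert function of the residue module `M / L`: the length of its component of
degree `n` (zero if that length is infinite). -/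
noncomputable def quotHilb (L : Submodule R M) (n : ℤ) : ℤ :=
  ((Module.length A (quotGrading ℳ L n)).toNat : ℤ)

omit [Decomposition ℳ] in
theorem quotHilb_top (n : ℤ) : quotHilb ℳ (⊤ : Submodule R M) n = 0 := by
  have : Subsingleton (M ⧸ (⊤ : Submodule R M)) := Submodule.Quotient.subsingleton_iff.2 rfl
  rw [quotHilb, Module.length_eq_zero]
  rfl

omit [Decomposition ℳ] in
theorem length_quotGrading_le (L : Submodule R M) (n : ℤ) :
    Module.length A (quotGrading ℳ L n) ≤ Module.length A (ℳ n) := by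
  refine Module.length_le_of_surjective
    ((L.mkQ.restrictScalars A).restrict (p := ℳ n) (q := quotGrading ℳ L n)
      fun x hx => ⟨x, hx, rfl⟩) ?_
  rintro ⟨y, x, hx, rfl⟩
  exact ⟨⟨x, hx⟩, rfl⟩

omit [Decomposition ℳ] in
theorem coe_quotHilb {L : Submodule R M} {n : ℤ} (h : Module.length A (ℳ n) ≠ ⊤) :
    Module.length A (quotGrading ℳ L n) =
      (((Module.length A (quotGrading ℳ L n)).toNat : ℕ) : ℕ∞) :=
  (ENat.natCast_toNat (ne_top_of_le_ne_top h (length_quotGrading_le ℳ L n))).symm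

omit [Decomposition ℳ] in
theorem length_quotGrading_bot (n : ℤ) :
    Module.length A (quotGrading ℳ (⊥ : Submodule R M) n) = Module.length A (ℳ n) := by
  refine ((Submodule.equivMapOfInjective _ ?_ (ℳ n)).length_eq).symm
  intro x y hxy
  have := (Submodule.Quotient.eq (⊥ : Submodule R M)).1 hxy
  rwa [Submodule.mem_bot, sub_eq_zero] at this

/-- Additivity of Hilbert functions along `0 → R / I → M / N → M / N' → 0`, the first map raising
degrees by `a`. -/
theorem quotHilb_eq_add_of_exact {ℳ : ℤ → Submodule A M} [Decomposition ℳ]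
    {ℛ : ℤ → Submodule A R} [Decomposition ℛ]
    (hℳ : ∀ n, Module.length A (ℳ n) ≠ ⊤) (hℛ : ∀ n, Module.length A (ℛ n) ≠ ⊤)
    {I : Ideal R} {N N' : Submodule R M} (hI : Submodule.IsHomogeneous I ℛ)
    (hN : N.IsHomogeneous ℳ) (hN' : N'.IsHomogeneous ℳ)
    (f : (R ⧸ I) →ₗ[R] M ⧸ N) (g : (M ⧸ N) →ₗ[R] M ⧸ N') (a : ℤ)
    (hf : ∀ n, ∀ x ∈ quotGrading ℛ I n, f x ∈ quotGrading ℳ N (n + a))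
    (hg : IsGradedHom (quotGrading ℳ N) (quotGrading ℳ N') g)
    (hinj : Function.Injective f) (hexact : Function.Exact f g) (hsurj : Function.Surjective g)
    (n : ℤ) : quotHilb ℳ N n = quotHilb ℛ I (n - a) + quotHilb ℳ N' n := by
  let _ := quotDecomposition hI
  let _ := quotDecomposition hN
  let _ := quotDecomposition hN'
  have h := length_eq_add_of_graded_exact (quotGrading ℛ I) (quotGrading ℳ N) (quotGrading ℳ N')
    (f.restrictScalars A) (g.restrictScalars A) a hf hg hinj hexact hsurj (n - a)
  rw [sub_add_cancel] at h
  rw [quotHilb, quotHilb, quotHilb, h, ENat.toNat_add, Nat.cast_add]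
  · exact ne_top_of_le_ne_top (hℛ _) (length_quotGrading_le ℛ I _)
  · exact ne_top_of_le_ne_top (hℳ n) (length_quotGrading_le ℳ N' n)

end Quotients

section GradedRing

variable {A R M : Type*} [CommRing A] [CommRing R] [Algebra A R] [AddCommGroup M] [Module A M]
  [Module R M] [IsScalarTower A R M]

/-- The ideal `(N : x)` of all scalars that multiply `x` into `N`. -/
def colonElem (N : Submodule R M) (x : M) : Ideal R :=
  N.comap (LinearMap.toSpanSingleton R M x)

theorem mem_colonElem {N : Submodule R M} {x : M} {r : R} : r ∈ colonElem N x ↔ r • x ∈ N :=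
  Iff.rfl

variable {ℛ : ℤ → Submodule A R} [Decomposition ℛ] {ℳ : ℤ → Submodule A M} [Decomposition ℳ]

omit [IsScalarTower A R M] [Decomposition ℛ] in
theorem homComp_smul (hsm : ∀ i j, ∀ a ∈ ℛ i, ∀ x ∈ ℳ j, a • x ∈ ℳ (i + j)) {i : ℤ} {a : R}
    (ha : a ∈ ℛ i) (x : M) (n : ℤ) : homComp ℳ (n + i) (a • x) = a • homComp ℳ n x :=
  homComp_map ℳ ℳ (DistribSMul.toAddMonoidHom M a) i
    (fun n x hx => by rw [add_comm]; exact hsm i n a ha x hx) n x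

omit [IsScalarTower A R M] in
theorem homComp_smul_of_mem (hsm : ∀ i j, ∀ a ∈ ℛ i, ∀ x ∈ ℳ j, a • x ∈ ℳ (i + j)) {i : ℤ} {x : M}
    (hx : x ∈ ℳ i) (a : R) (n : ℤ) : homComp ℳ (n + i) (a • x) = homComp ℛ n a • x :=
  homComp_map ℛ ℳ (LinearMap.toSpanSingleton R M x).toAddMonoidHom i
    (fun n a ha => hsm n i a ha x hx) n a

omit [IsScalarTower A R M] in
theorem isHomogeneous_colonElem (hsm : ∀ i j, ∀ a ∈ ℛ i, ∀ x ∈ ℳ j, a • x ∈ ℳ (i + j))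
    {N : Submodule R M} (hN : N.IsHomogeneous ℳ) {i : ℤ} {x : M} (hx : x ∈ ℳ i) :
    Submodule.IsHomogeneous (colonElem N x) ℛ := by
  refine isHomogeneous_iff.2 fun n r hr => ?_
  rw [mem_colonElem, ← homComp_smul_of_mem hsm hx]
  exact isHomogeneous_iff.1 hN _ _ hr

omit [IsScalarTower A R M] in
theorem isHomogeneous_sup_span (hsm : ∀ i j, ∀ a ∈ ℛ i, ∀ x ∈ ℳ j, a • x ∈ ℳ (i + j))
    {N : Submodule R M} (hN : N.IsHomogeneous ℳ) {i : ℤ} {x : M} (hx : x ∈ ℳ i) :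
    (N ⊔ Submodule.span R {x}).IsHomogeneous ℳ := by
  refine isHomogeneous_iff.2 fun n y hy => ?_
  obtain ⟨z, hz, w, hw, rfl⟩ := Submodule.mem_sup.1 hy
  obtain ⟨r, rfl⟩ := Submodule.mem_span_singleton.1 hw
  rw [map_add, ← sub_add_cancel n i, homComp_smul_of_mem hsm hx]
  exact Submodule.add_mem_sup (isHomogeneous_iff.1 hN _ _ hz)
    (Submodule.mem_span_singleton.2 ⟨_, rfl⟩)

omit [Algebra A R] [IsScalarTower A R M] in
theorem isHomogeneous_bot : (⊥ : Submodule R M).IsHomogeneous ℳ := by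
  refine isHomogeneous_iff.2 fun n x hx => ?_
  rw [(Submodule.mem_bot R).1 hx, map_zero]
  exact zero_mem _

omit [Algebra A R] [IsScalarTower A R M] in
theorem isHomogeneous_top : (⊤ : Submodule R M).IsHomogeneous ℳ :=
  isHomogeneous_iff.2 fun _ _ _ => Submodule.mem_top

/-- The multiplication map `R / (N : x) → M / N`, `1 ↦ x`. -/
noncomputable def colonElemMap (N : Submodule R M) (x : M) : (R ⧸ colonElem N x) →ₗ[R] M ⧸ N :=
  (colonElem N x).mapQ N (LinearMap.toSpanSingleton R M x) le_rfl

theorem colonElemMap_mk (N : Submodule R M) (x : M) (r : R) :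
    colonElemMap N x ((colonElem N x).mkQ r) = N.mkQ (r • x) := rfl

theorem colonElemMap_injective (N : Submodule R M) (x : M) :
    Function.Injective (colonElemMap N x) := by
  rw [injective_iff_map_eq_zero]
  intro y hy
  obtain ⟨r, rfl⟩ := (colonElem N x).mkQ_surjective y
  rw [colonElemMap_mk] at hy
  exact (Submodule.Quotient.mk_eq_zero _).2 ((Submodule.Quotient.mk_eq_zero N).1 hy)

theorem colonElemMap_exact (N : Submodule R M) (x : M) :
    Function.Exact (colonElemMap N x)
      (Submodule.factor (le_sup_left : N ≤ N ⊔ Submodule.span R {x})) := by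
  intro y
  obtain ⟨m, rfl⟩ := N.mkQ_surjective y
  constructor
  · intro hm
    have hm' : m ∈ N ⊔ Submodule.span R {x} := (Submodule.Quotient.mk_eq_zero _).1 hm
    obtain ⟨z, hz, w, hw, rfl⟩ := Submodule.mem_sup.1 hm'
    obtain ⟨r, rfl⟩ := Submodule.mem_span_singleton.1 hw
    refine ⟨(colonElem N x).mkQ r, ?_⟩
    have hz' : N.mkQ z = 0 := (Submodule.Quotient.mk_eq_zero N).2 hz
    rw [colonElemMap_mk, map_add, hz', zero_add]
  · rintro ⟨s, hs⟩
    obtain ⟨r, rfl⟩ := (colonElem N x).mkQ_surjective s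
    rw [← hs, colonElemMap_mk]
    exact (Submodule.Quotient.mk_eq_zero _).2
      (Submodule.mem_sup_right (Submodule.mem_span_singleton.2 ⟨r, rfl⟩))

omit [Decomposition ℛ] [Decomposition ℳ] in
theorem colonElemMap_mem (hsm : ∀ i j, ∀ a ∈ ℛ i, ∀ x ∈ ℳ j, a • x ∈ ℳ (i + j))
    (N : Submodule R M) {a : ℤ} {x : M} (hx : x ∈ ℳ a) (n : ℤ) :
    ∀ s ∈ quotGrading ℛ (colonElem N x) n, colonElemMap N x s ∈ quotGrading ℳ N (n + a) := by
  rintro _ ⟨r, hr, rfl⟩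
  exact ⟨r • x, hsm n a r hr x hx, rfl⟩

omit [Decomposition ℳ] in
theorem isGradedHom_factor {N N' : Submodule R M} (h : N ≤ N') :
    IsGradedHom (quotGrading ℳ N) (quotGrading ℳ N') (Submodule.factor h) := by
  rintro n _ ⟨x, hx, rfl⟩
  exact ⟨x, hx, rfl⟩

theorem quotHilb_sup_span (hsm : ∀ i j, ∀ a ∈ ℛ i, ∀ x ∈ ℳ j, a • x ∈ ℳ (i + j))
    (hℳ : ∀ n, Module.length A (ℳ n) ≠ ⊤) (hℛ : ∀ n, Module.length A (ℛ n) ≠ ⊤)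
    {N : Submodule R M} (hN : N.IsHomogeneous ℳ) {a : ℤ} {x : M} (hx : x ∈ ℳ a) (n : ℤ) :
    quotHilb ℳ N n =
      quotHilb ℛ (colonElem N x) (n - a) + quotHilb ℳ (N ⊔ Submodule.span R {x}) n :=
  quotHilb_eq_add_of_exact hℳ hℛ (isHomogeneous_colonElem hsm hN hx) hN
    (isHomogeneous_sup_span hsm hN hx) (colonElemMap N x) (Submodule.factor le_sup_left) a
    (colonElemMap_mem hsm N hx) (isGradedHom_factor _) (colonElemMap_injective N x)
    (colonElemMap_exact N x) (Submodule.factor_surjective _) n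

omit [Decomposition ℳ] in
theorem quotHilb_antitone (hℳ : ∀ n, Module.length A (ℳ n) ≠ ⊤) {N N' : Submodule R M}
    (h : N ≤ N') (n : ℤ) : quotHilb ℳ N' n ≤ quotHilb ℳ N n := by
  have h1 : Module.length A (quotGrading ℳ N' n) ≤ Module.length A (quotGrading ℳ N n) := by
    refine Module.length_le_of_surjective (((Submodule.factor h).restrictScalars A).restrict
      (p := quotGrading ℳ N n) (q := quotGrading ℳ N' n) (isGradedHom_factor h n)) ?_
    rintro ⟨_, x, hx, rfl⟩
    exact ⟨⟨N.mkQ x, x, hx, rfl⟩, rfl⟩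
  rw [quotHilb, quotHilb, Nat.cast_le]
  exact ENat.toNat_le_toNat h1 (ne_top_of_le_ne_top (hℳ n) (length_quotGrading_le ℳ N n))

end GradedRing

/-! ### Homogeneous prime filtrations -/

section Devissage

variable {A R M : Type*} [CommRing A] [CommRing R] [Algebra A R] [AddCommGroup M] [Module A M]
  [Module R M] [IsScalarTower A R M] {ℛ : ℤ → Submodule A R} [GradedRing ℛ]
  {ℳ : ℤ → Submodule A M} [Decomposition ℳ]

omit [IsScalarTower A R M] in
/-- If `N ⊉ L` are homogeneous, then some homogeneous element of `L` spans modulo `N` a copy of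
`R / 𝔮` with `𝔮` a prime. An annihilator that is maximal among those of nonzero homogeneous elements
of `L / (L ∩ N)` is such a prime. -/
theorem exists_isPrime_colonElem [IsNoetherianRing R]
    (hsm : ∀ i j, ∀ a ∈ ℛ i, ∀ x ∈ ℳ j, a • x ∈ ℳ (i + j))
    {N L : Submodule R M} (hN : N.IsHomogeneous ℳ) (hL : L.IsHomogeneous ℳ) (h : ¬ L ≤ N) :
    ∃ (b : ℤ) (y : M), y ∈ ℳ b ∧ y ∈ L ∧ y ∉ N ∧ (colonElem N y).IsPrime := by
  let S : Set (Ideal R) := {I | ∃ (b : ℤ) (y : M), y ∈ ℳ b ∧ y ∈ L ∧ y ∉ N ∧ colonElem N y = I}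
  have hS : S.Nonempty := by
    obtain ⟨y, hyL, hyN⟩ := Set.not_subset.1 h
    by_contra hne
    rw [Set.not_nonempty_iff_eq_empty] at hne
    refine hyN (mem_of_forall_homComp_mem ℳ fun n => ?_)
    by_contra hn
    exact Set.eq_empty_iff_forall_notMem.1 hne _
      ⟨n, homComp ℳ n y, homComp_mem ℳ n y, isHomogeneous_iff.1 hL n y hyL, hn, rfl⟩
  obtain ⟨I, ⟨b, y, hyb, hyL, hyN, rfl⟩, hmax⟩ := set_has_maximal_iff_noetherian.2 ‹_› S hS
  refine ⟨b, y, hyb, hyL, hyN, ?_⟩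
  refine Ideal.IsHomogeneous.isPrime_of_homogeneous_mem_or_mem (𝒜 := ℛ)
    (isHomogeneous_colonElem hsm hN hyb) ?_ ?_
  · rw [Ne, Ideal.eq_top_iff_one, mem_colonElem, one_smul]
    exact hyN
  · rintro r s - ⟨j, hs⟩ hrs
    by_cases hsy : s ∈ colonElem N y
    · exact Or.inr hsy
    · left
      have hle : colonElem N y ≤ colonElem N (s • y) := fun u hu => by
        rw [mem_colonElem, smul_comm]
        exact N.smul_mem s hu
      have heq := hmax _ ⟨j + b, s • y, hsm j b s hs y hyb, L.smul_mem s hyL, hsy, rfl⟩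
      have : colonElem N (s • y) ≤ colonElem N y := by
        by_contra hc
        exact heq (lt_of_le_not_ge hle hc)
      refine this ?_
      rwa [mem_colonElem, smul_smul]

/-- Dévissage: if the Hilbert functions of all `R / 𝔮`, with `𝔮` a homogeneous prime containing the
annihilator of `L / N`, are polynomial of degree less than `s`, then so is that of `L / N`. -/
theorem isNumPoly_quotHilb_sub [IsNoetherianRing R] [IsNoetherian R M]
    (hsm : ∀ i j, ∀ a ∈ ℛ i, ∀ x ∈ ℳ j, a • x ∈ ℳ (i + j))
    (hℳ : ∀ n, Module.length A (ℳ n) ≠ ⊤) (hℛ : ∀ n, Module.length A (ℛ n) ≠ ⊤)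
    {N L : Submodule R M} (hN : N.IsHomogeneous ℳ) (hL : L.IsHomogeneous ℳ) (hNL : N ≤ L) (s : ℕ)
    (hs : ∀ 𝔮 : Ideal R, 𝔮.IsPrime → 𝔮.IsHomogeneous ℛ →
      (∀ r : R, (∀ x ∈ L, r • x ∈ N) → r ∈ 𝔮) → IsNumPoly s (quotHilb ℛ 𝔮)) :
    IsNumPoly s (quotHilb ℳ N - quotHilb ℳ L) := by
  induction N using IsNoetherian.induction with
  | hgt N ih =>
    rcases hNL.eq_or_lt with rfl | hlt
    · rw [sub_self]
      exact IsNumPoly.zero s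
    · obtain ⟨b, y, hyb, hyL, hyN, hprime⟩ :=
        exists_isPrime_colonElem hsm hN hL (not_le_of_gt hlt)
      have hle : N ⊔ Submodule.span R {y} ≤ L :=
        sup_le hNL ((Submodule.span_singleton_le_iff_mem _ _).2 hyL)
      have hgt : N < N ⊔ Submodule.span R {y} := by
        refine lt_of_le_of_ne le_sup_left fun h => hyN ?_
        rw [h]
        exact Submodule.mem_sup_right (Submodule.mem_span_singleton_self y)
      have h1 := ih _ hgt (isHomogeneous_sup_span hsm hN hyb) hle fun 𝔮 h𝔮 h𝔮' hr =>
        hs 𝔮 h𝔮 h𝔮' fun r hr' => hr r fun x hx => hgt.le (hr' x hx)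
      have h2 := (hs _ hprime (isHomogeneous_colonElem hsm hN hyb) fun r hr => hr y hyL).shift b
      refine (h2.add h1).congr (Eventually.of_forall fun n => ?_)
      simp only [Pi.add_apply, Pi.sub_apply]
      rw [quotHilb_sup_span hsm hℳ hℛ hN hyb n]
      ring

end Devissage

section FiniteLength

variable {A R M : Type*} [CommRing A] [CommRing R] [Algebra A R] [AddCommGroup M] [Module A M]
  [Module R M] [IsScalarTower A R M] {ℛ : ℤ → Submodule A R} [Decomposition ℛ]
  {ℳ : ℤ → Submodule A M} [Decomposition ℳ]

/-- The homogeneous components of a Noetherian graded module are Noetherian modules over the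
degree zero part of the ring: `U ↦ R U` embeds the submodules of a component into those of `M`. -/
theorem isNoetherian_component [IsNoetherian R M]
    (hsm : ∀ i j, ∀ a ∈ ℛ i, ∀ x ∈ ℳ j, a • x ∈ ℳ (i + j))
    (h0 : ∀ r ∈ ℛ 0, ∃ a : A, algebraMap A R a = r) (n : ℤ) : IsNoetherian A (ℳ n) := by
  let F : Submodule A (ℳ n) → Submodule R M := fun U => Submodule.span R ((↑) '' (U : Set (ℳ n)))
  have key : ∀ (U : Submodule A (ℳ n)) (u : ℳ n), (u : M) ∈ F U → u ∈ U := by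
    intro U u hu
    have hall : ∀ x ∈ F U, ∀ r : R, ∃ v ∈ U, homComp ℳ n (r • x) = v := by
      intro x hx
      induction hx using Submodule.span_induction with
      | mem x hx =>
        obtain ⟨v, hv, rfl⟩ := hx
        intro r
        obtain ⟨a, ha⟩ := h0 _ (homComp_mem ℛ 0 r)
        refine ⟨a • v, U.smul_mem a hv, ?_⟩
        have := homComp_smul_of_mem hsm v.2 r 0
        rw [zero_add] at this
        rw [this, ← ha, algebraMap_smul]
        rfl
      | zero => exact fun r => ⟨0, U.zero_mem, by simp⟩
      | add x y _ _ hx hy =>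
        intro r
        obtain ⟨v, hv, hv'⟩ := hx r
        obtain ⟨w, hw, hw'⟩ := hy r
        exact ⟨v + w, U.add_mem hv hw, by rw [smul_add, map_add, hv', hw']; rfl⟩
      | smul s x _ hx =>
        intro r
        rw [smul_smul]
        exact hx (r * s)
    obtain ⟨v, hv, h⟩ := hall u hu 1
    rw [one_smul, homComp_of_mem u.2] at h
    rwa [Subtype.ext h]
  have hmono : StrictMono F := by
    intro U V hUV
    refine lt_of_le_not_ge (Submodule.span_mono (Set.image_mono hUV.le)) fun h => ?_
    exact not_le_of_gt hUV fun v hv => key U v (h (Submodule.subset_span ⟨v, hv, rfl⟩))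
  exact isNoetherian_iff'.2 hmono.wellFoundedGT

theorem length_component_ne_top [IsArtinianRing A] [IsNoetherian R M]
    (hsm : ∀ i j, ∀ a ∈ ℛ i, ∀ x ∈ ℳ j, a • x ∈ ℳ (i + j))
    (h0 : ∀ r ∈ ℛ 0, ∃ a : A, algebraMap A R a = r) (n : ℤ) : Module.length A (ℳ n) ≠ ⊤ := by
  have := isNoetherian_component hsm h0 n
  exact Module.length_ne_top

end FiniteLength

/-! ### Standard graded rings -/

section RingGrading

variable {R : Type*} [CommRing R] (𝒜 : ℕ → AddSubgroup R) [GradedRing 𝒜]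

theorem mem_ringGrading_one {x : R} : x ∈ ringGrading 𝒜 1 ↔ x ∈ 𝒜 1 := Iff.rfl

theorem ringGrading_of_neg {n : ℤ} (hn : n < 0) : ringGrading 𝒜 n = ⊥ := by
  obtain ⟨m, rfl⟩ := Int.eq_negSucc_of_lt_zero hn
  rfl

theorem ringGrading_mul_mem {i j : ℤ} {a b : R} (ha : a ∈ ringGrading 𝒜 i)
    (hb : b ∈ ringGrading 𝒜 j) : a * b ∈ ringGrading 𝒜 (i + j) := by
  rcases lt_or_ge i 0 with hi | hi
  · rw [ringGrading_of_neg 𝒜 hi, Submodule.mem_bot] at ha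
    rw [ha, zero_mul]
    exact zero_mem _
  rcases lt_or_ge j 0 with hj | hj
  · rw [ringGrading_of_neg 𝒜 hj, Submodule.mem_bot] at hb
    rw [hb, mul_zero]
    exact zero_mem _
  obtain ⟨i, rfl⟩ := Int.eq_ofNat_of_zero_le hi
  obtain ⟨j, rfl⟩ := Int.eq_ofNat_of_zero_le hj
  exact SetLike.GradedMul.mul_mem (A := 𝒜) ha hb

/-- The component of degree `n` of an element of an `ℕ`-graded ring, as a linear map over the ring
of elements of degree zero. -/
def ringComp (n : ℕ) : R →ₗ[𝒜 0] R where
  toFun x := decompose 𝒜 x n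
  map_add' x y := by simp
  map_smul' a x := coe_decompose_mul_of_left_mem_zero 𝒜 a.2

/-- `R = ⨁ R_n`, the sum being extended by zero to negative degrees. -/
noncomputable instance ringGradingDecomposition : Decomposition (ringGrading 𝒜) := by
  refine IsInternal.chooseDecomposition _
    ((isInternal_submodule_iff_iSupIndep_and_iSup_eq_top _).2 ⟨fun i => ?_, ?_⟩)
  · rcases lt_or_ge i 0 with hi | hi
    · rw [ringGrading_of_neg 𝒜 hi]
      exact disjoint_bot_left
    · obtain ⟨n, rfl⟩ := Int.eq_ofNat_of_zero_le hi
      rw [Submodule.disjoint_def]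
      intro x hx hx'
      have h0 : ⨆ j, ⨆ (_ : j ≠ (n : ℤ)), ringGrading 𝒜 j ≤ LinearMap.ker (ringComp 𝒜 n) := by
        refine iSup₂_le fun j hj z hz => ?_
        rcases lt_or_ge j 0 with hj' | hj'
        · rw [ringGrading_of_neg 𝒜 hj', Submodule.mem_bot] at hz
          rw [hz]
          exact zero_mem _
        · obtain ⟨m, rfl⟩ := Int.eq_ofNat_of_zero_le hj'
          exact decompose_of_mem_ne 𝒜 hz fun h => hj (by rw [h])
      have h1 : (decompose 𝒜 x n : R) = 0 := h0 hx'
      rwa [decompose_of_mem_same 𝒜 hx] at h1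
  · rw [eq_top_iff]
    intro x _
    classical
    rw [← sum_support_decompose 𝒜 x]
    exact sum_mem fun n _ => Submodule.mem_iSup_of_mem (n : ℤ) (decompose 𝒜 x n).2

noncomputable instance ringGradingGradedRing : GradedRing (ringGrading 𝒜) where
  one_mem := SetLike.GradedOne.one_mem (A := 𝒜)
  mul_mem _ _ _ _ := ringGrading_mul_mem 𝒜

theorem ringGrading_smul_mem :
    ∀ i j, ∀ a ∈ ringGrading 𝒜 i, ∀ x ∈ ringGrading 𝒜 j, a • x ∈ ringGrading 𝒜 (i + j) :=
  fun _ _ _ ha _ hx => ringGrading_mul_mem 𝒜 ha hx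

theorem exists_algebraMap_eq_of_mem_ringGrading_zero :
    ∀ r ∈ ringGrading 𝒜 0, ∃ a : 𝒜 0, algebraMap (𝒜 0) R a = r :=
  fun r hr => ⟨⟨r, hr⟩, rfl⟩

variable [IsNoetherianRing R]

theorem length_ringGrading_ne_top [IsArtinianRing (𝒜 0)] (n : ℤ) :
    Module.length (𝒜 0) (ringGrading 𝒜 n) ≠ ⊤ :=
  length_component_ne_top (ringGrading_smul_mem 𝒜)
    (exists_algebraMap_eq_of_mem_ringGrading_zero 𝒜) n

omit [IsNoetherianRing R] in
/-- In a standard graded ring, a homogeneous ideal that contains all elements of degree one contains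
all elements of positive degree. -/
theorem mem_of_adjoin_eq_top (h_std : Algebra.adjoin (𝒜 0) (𝒜 1 : Set R) = ⊤)
    {𝔮 : Ideal R} (hhom : 𝔮.IsHomogeneous (ringGrading 𝒜)) (h1 : ∀ z ∈ 𝒜 1, z ∈ 𝔮) {n : ℤ}
    (hn : 0 < n) {x : R} (hx : x ∈ ringGrading 𝒜 n) : x ∈ 𝔮 := by
  have key : ∀ y : R, ∃ a : 𝒜 0, y - algebraMap (𝒜 0) R a ∈ 𝔮 := by
    intro y
    have hy : y ∈ Algebra.adjoin (𝒜 0) (𝒜 1 : Set R) := h_std ▸ Algebra.mem_top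
    induction hy using Algebra.adjoin_induction with
    | mem y hy => exact ⟨0, by simpa using h1 y hy⟩
    | algebraMap a => exact ⟨a, by simp⟩
    | add y z _ _ hy hz =>
      obtain ⟨a, ha⟩ := hy
      obtain ⟨b, hb⟩ := hz
      refine ⟨a + b, ?_⟩
      rw [map_add, add_sub_add_comm]
      exact add_mem ha hb
    | mul y z _ _ hy hz =>
      obtain ⟨a, ha⟩ := hy
      obtain ⟨b, hb⟩ := hz
      refine ⟨a * b, ?_⟩
      have : y * z - algebraMap (𝒜 0) R (a * b) =
          (y - algebraMap (𝒜 0) R a) * z +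
            algebraMap (𝒜 0) R a * (z - algebraMap (𝒜 0) R b) := by
        rw [map_mul]
        ring
      rw [this]
      exact add_mem (𝔮.mul_mem_right _ ha) (𝔮.mul_mem_left _ hb)
  obtain ⟨a, ha⟩ := key x
  have h := isHomogeneous_iff.1 hhom n _ ha
  have h0 : algebraMap (𝒜 0) R a ∈ ringGrading 𝒜 0 := a.2
  rwa [map_sub, homComp_of_mem hx, homComp_of_mem_ne h0 hn.ne, sub_zero] at h

/-- Hilbert–Serre: for a homogeneous prime `𝔮`, the Hilbert function of `R / 𝔮` is eventually
polynomial of degree less than `dim R / 𝔮`. -/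
theorem isNumPoly_quotHilb_of_ringKrullDim_le [IsArtinianRing (𝒜 0)]
    (h_std : Algebra.adjoin (𝒜 0) (𝒜 1 : Set R) = ⊤) (s : ℕ) (𝔮 : Ideal R) (h𝔮 : 𝔮.IsPrime)
    (hhom : 𝔮.IsHomogeneous (ringGrading 𝒜)) (hdim : ringKrullDim (R ⧸ 𝔮) ≤ s) :
    IsNumPoly s (quotHilb (ringGrading 𝒜) 𝔮) := by
  induction s using Nat.strong_induction_on generalizing 𝔮 with
  | _ s ih =>
  by_cases h1 : ∀ z ∈ 𝒜 1, z ∈ 𝔮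
  · refine IsNumPoly.mono (Nat.zero_le s) (isNumPoly_zero_iff.2 ?_)
    filter_upwards [eventually_gt_atTop 0] with n hn
    have : quotGrading (ringGrading 𝒜) 𝔮 n = ⊥ := by
      rw [eq_bot_iff]
      rintro _ ⟨x, hx, rfl⟩
      exact (Submodule.Quotient.mk_eq_zero 𝔮).2 (mem_of_adjoin_eq_top 𝒜 h_std hhom h1 hn hx)
    rw [quotHilb, this, Module.length_eq_zero]
    rfl
  · push Not at h1
    obtain ⟨z, hz, hz𝔮⟩ := h1
    have hcolon : colonElem 𝔮 z = 𝔮 := by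
      ext r
      rw [mem_colonElem, smul_eq_mul]
      exact ⟨fun h => (h𝔮.mem_or_mem h).resolve_right hz𝔮, fun h => 𝔮.mul_mem_right z h⟩
    set J : Ideal R := 𝔮 ⊔ Submodule.span R {z} with hJ
    have hJhom : Submodule.IsHomogeneous J (ringGrading 𝒜) :=
      isHomogeneous_sup_span (ringGrading_smul_mem 𝒜) hhom ((mem_ringGrading_one 𝒜).2 hz)
    have hrec : ∀ n, bwdDiff (quotHilb (ringGrading 𝒜) 𝔮) n = quotHilb (ringGrading 𝒜) J n := by
      intro n
      rw [bwdDiff_apply, quotHilb_sup_span (ringGrading_smul_mem 𝒜)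
        (length_ringGrading_ne_top 𝒜) (length_ringGrading_ne_top 𝒜) hhom
        ((mem_ringGrading_one 𝒜).2 hz) n, hcolon]
      ring
    -- Cutting down by `z` lowers the dimension, since `z` is a nonzerodivisor on `R / 𝔮`.
    have hdrop : ∀ 𝔮' : Ideal R, 𝔮'.IsPrime → J ≤ 𝔮' → ringKrullDim (R ⧸ 𝔮') + 1 ≤ s := by
      intro 𝔮' _ hle
      refine le_trans ?_ hdim
      have hne : Ideal.Quotient.mk 𝔮 z ≠ 0 := fun h => hz𝔮 (Ideal.Quotient.eq_zero_iff_mem.1 h)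
      refine ringKrullDim_succ_le_of_surjective
        (Ideal.Quotient.factor (le_sup_left.trans hle)) (Ideal.Quotient.factor_surjective _)
        (mem_nonZeroDivisors_of_ne_zero hne) ?_
      rw [Ideal.Quotient.factor_mk, Ideal.Quotient.eq_zero_iff_mem]
      exact hle (Submodule.mem_sup_right (Submodule.mem_span_singleton_self z))
    -- If `1 = q + r z`, comparing components of degree zero gives `1 ∈ 𝔮`, as `z` has degree one.
    have hJtop : J ≠ ⊤ := by
      intro h
      obtain ⟨q, hq, w, hw, hqw⟩ := Submodule.mem_sup.1 ((Ideal.eq_top_iff_one J).1 h)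
      obtain ⟨r, rfl⟩ := Submodule.mem_span_singleton.1 hw
      have h2 := congrArg (homComp (ringGrading 𝒜) ((-1) + 1)) hqw
      have hone : (1 : R) ∈ ringGrading 𝒜 (-1 + 1) := SetLike.GradedOne.one_mem (A := 𝒜)
      rw [map_add, homComp_smul_of_mem (ringGrading_smul_mem 𝒜) ((mem_ringGrading_one 𝒜).2 hz),
        homComp_of_mem hone] at h2
      have h3 : homComp (ringGrading 𝒜) (-1) r = 0 := by
        have := homComp_mem (ringGrading 𝒜) (-1) r
        rwa [ringGrading_of_neg 𝒜 (by norm_num), Submodule.mem_bot] at this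
      rw [h3, zero_smul, add_zero] at h2
      exact h𝔮.ne_top ((Ideal.eq_top_iff_one 𝔮).2 (h2 ▸ isHomogeneous_iff.1 hhom _ _ hq))
    cases s with
    | zero =>
      obtain ⟨𝔪, h𝔪, hle⟩ := Ideal.exists_le_maximal J hJtop
      have h2 := hdrop 𝔪 h𝔪.isPrime hle
      have h3 : (0 : WithBot ℕ∞) ≤ ringKrullDim (R ⧸ 𝔪) := ringKrullDim_nonneg_of_nontrivial
      have h4 : (1 : WithBot ℕ∞) ≤ 0 := by
        refine le_trans ?_ h2
        simpa using add_le_add_left h3 1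
      exact absurd h4 (by decide)
    | succ s =>
      rw [isNumPoly_succ_iff]
      have h2 := isNumPoly_quotHilb_sub (ringGrading_smul_mem 𝒜)
        (length_ringGrading_ne_top 𝒜) (length_ringGrading_ne_top 𝒜) hJhom isHomogeneous_top le_top
        s fun 𝔮' h𝔮' hhom' hann => by
          refine ih s (Nat.lt_succ_self s) 𝔮' h𝔮' hhom' ?_
          have h3 := hdrop 𝔮' h𝔮' fun r hr => hann r fun x _ => J.mul_mem_right x hr
          rw [Nat.cast_succ] at h3
          exact ENat.WithBot.add_le_add_one_right_iff.1 h3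
      refine h2.congr (Eventually.of_forall fun n => ?_)
      rw [hrec, Pi.sub_apply, quotHilb_top, sub_zero]

end RingGrading

/-! ### Primes of height one in finitely generated domains -/

/-- Noether normalization for a domain `S` of finite type over `k`, with the number of variables
bounded below by the dimension of `S`. -/
theorem exists_mvPolynomial_isIntegral_of_le_ringKrullDim (k S : Type*) [Field k] [CommRing S]
    [IsDomain S] [Algebra k S] [Algebra.FiniteType k S] {d : ℕ} (hd : d ≤ ringKrullDim S) :
    ∃ (s : ℕ) (g : MvPolynomial (Fin s) k →ₐ[k] S),
      d ≤ s ∧ Function.Injective g ∧ g.IsIntegral := by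
  obtain ⟨s, g, hinj, hint⟩ := exists_integral_inj_algHom_of_fg k S
  refine ⟨s, g, ?_, hinj, hint⟩
  let _ := g.toRingHom.toAlgebra
  have : Algebra.IsIntegral (MvPolynomial (Fin s) k) S := ⟨hint⟩
  have h1 : ringKrullDim S ≤ ringKrullDim (MvPolynomial (Fin s) k) := by
    refine Order.krullDim_le_of_strictMono
      (PrimeSpectrum.comap (algebraMap (MvPolynomial (Fin s) k) S)) ?_
    intro P P' hlt
    obtain ⟨x, hx, hx'⟩ := Set.exists_of_ssubset (show (P.asIdeal : Set S) ⊂ P'.asIdeal from hlt)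
    exact Ideal.comap_lt_comap_of_integral_mem_sdiff hlt.le ⟨hx, hx'⟩
      (Algebra.IsIntegral.isIntegral x)
  have h2 := hd.trans h1
  rw [MvPolynomial.ringKrullDim_of_isNoetherianRing, ringKrullDim_eq_zero_of_field, zero_add,
    Nat.card_eq_fintype_card, Fintype.card_fin] at h2
  exact_mod_cast h2

/-- A domain `S` of dimension at least `d` and of finite type over a field `k`, modulo a prime of
height one, contains a polynomial ring over `k` in at least `d - 1` variables: by Noether
normalization and going down, the height one prime lies over a principal prime `(f)` of a
polynomial ring, and omitting a variable that occurs in `f` leaves a polynomial ring that meets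
`(f)` trivially. -/
theorem exists_mvPolynomial_injective_of_height_le_one (k S : Type*) [Field k] [CommRing S]
    [IsDomain S] [Algebra k S] [Algebra.FiniteType k S] {d : ℕ} (hd : d ≤ ringKrullDim S)
    (Q : Ideal S) [Q.IsPrime] (hQ : Q ≠ ⊥) (hht : Q.height ≤ 1) :
    ∃ (s : ℕ) (i : Fin s) (φ : MvPolynomial {j : Fin s // j ≠ i} k →ₐ[k] S ⧸ Q),
      d ≤ s ∧ Function.Injective φ := by
  obtain ⟨s, g, hds, hinj, hint⟩ := exists_mvPolynomial_isIntegral_of_le_ringKrullDim k S hd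
  let _ := g.toRingHom.toAlgebra
  have : Algebra.IsIntegral (MvPolynomial (Fin s) k) S := ⟨hint⟩
  have : FaithfulSMul (MvPolynomial (Fin s) k) S :=
    (faithfulSMul_iff_algebraMap_injective _ _).2 hinj
  set 𝔫 : Ideal (MvPolynomial (Fin s) k) := Q.under (MvPolynomial (Fin s) k) with h𝔫
  have h𝔫0 : 𝔫 ≠ ⊥ := fun h => hQ (Ideal.eq_bot_of_comap_eq_bot h)
  obtain ⟨f, hf𝔫, hf⟩ := Ideal.IsPrime.exists_mem_prime_of_ne_bot (inferInstance : 𝔫.IsPrime) h𝔫0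
  have hfprime : (Ideal.span {f}).IsPrime := (Ideal.span_singleton_prime hf.ne_zero).2 hf
  -- Going down applies because the polynomial ring is integrally closed.
  obtain ⟨Q₁, hQ₁le, hQ₁, hQ₁over⟩ := Ideal.exists_ideal_le_liesOver_of_le
    (p := Ideal.span {f}) (q := 𝔫) Q ((Ideal.span_singleton_le_iff_mem _).2 hf𝔫)
  have hQ₁bot : Q₁ ≠ ⊥ := by
    intro h
    have h1 : f ∈ Q₁.under (MvPolynomial (Fin s) k) :=
      hQ₁over.over ▸ Ideal.mem_span_singleton_self f
    rw [h, Ideal.under_def, Ideal.mem_comap, Ideal.mem_bot] at h1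
    exact hf.ne_zero (hinj (h1.trans (map_zero g).symm))
  -- A nonzero prime contained in a prime of height at most one equals it.
  have hQ₁Q : Q₁ = Q := by
    by_contra hne
    have h1 := Ideal.height_add_one_le_of_lt_of_isPrime (lt_of_le_of_ne hQ₁le hne)
    have h2 : Q₁.height = 0 := by
      have h3 : Q₁.height + 1 ≤ 0 + 1 := by simpa using h1.trans hht
      exact le_antisymm ((ENat.add_le_add_iff_right (by simp)).1 h3) bot_le
    exact hQ₁bot (Ideal.height_eq_zero_iff_eq_bot.1 h2)
  subst hQ₁Q
  -- Some variable occurs in `f`, since `f` is not a unit and so not constant.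
  obtain ⟨i, hi⟩ : ∃ i, f.degreeOf i ≠ 0 := by
    by_contra! hall
    have h0 : f.totalDegree = 0 := by
      rw [MvPolynomial.totalDegree_eq_zero_iff]
      intro m hm j
      have := MvPolynomial.monomial_le_degreeOf j hm
      rw [hall j] at this
      omega
    rw [MvPolynomial.totalDegree_eq_zero_iff_eq_C] at h0
    refine hf.not_isUnit ?_
    rw [h0]
    refine (IsUnit.mk0 _ fun hc => hf.ne_zero ?_).map MvPolynomial.C
    rw [h0, hc, map_zero]
  let ψ : MvPolynomial {j : Fin s // j ≠ i} k →ₐ[k] MvPolynomial (Fin s) k :=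
    MvPolynomial.rename Subtype.val
  refine ⟨s, i, ((Ideal.Quotient.mkₐ k Q₁).comp g).comp ψ, hds, ?_⟩
  rw [injective_iff_map_eq_zero]
  intro p hp
  have hp' : Ideal.Quotient.mk Q₁ (g (ψ p)) = 0 := hp
  have h1 : ψ p ∈ Q₁.under (MvPolynomial (Fin s) k) :=
    show g (ψ p) ∈ Q₁ from Ideal.Quotient.eq_zero_iff_mem.1 hp'
  rw [← hQ₁over.over, Ideal.mem_span_singleton] at h1
  obtain ⟨q, hq⟩ := h1
  by_contra hp0
  have hψ0 : ψ p ≠ 0 := fun h =>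
    hp0 (MvPolynomial.rename_injective _ Subtype.val_injective (h.trans (map_zero _).symm))
  have hq0 : q ≠ 0 := by
    rintro rfl
    exact hψ0 (by rw [hq, mul_zero])
  have h2 : (ψ p).degreeOf i = 0 := by
    classical
    by_contra h0
    have h3 : i ∈ (ψ p).vars := MvPolynomial.mem_vars_iff_degreeOf_ne_zero.2 h0
    obtain ⟨j, -, hj⟩ := Finset.mem_image.1 (MvPolynomial.vars_rename _ _ h3)
    exact j.2 hj
  rw [hq, MvPolynomial.degreeOf_mul_eq hf.ne_zero hq0] at h2
  omega

/-! ### Growth of Hilbert functions -/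

section Growth

theorem length_sup_le {A M : Type*} [CommRing A] [AddCommGroup M] [Module A M]
    (U V : Submodule A M) :
    Module.length A ↥(U ⊔ V) ≤ Module.length A U + Module.length A V := by
  have h : LinearMap.range (U.subtype.coprod V.subtype) = U ⊔ V := by
    rw [LinearMap.range_coprod, Submodule.range_subtype, Submodule.range_subtype]
  rw [← h, ← Module.length_prod]
  exact Module.length_le_of_surjective _ (LinearMap.surjective_rangeRestrict _)

theorem length_le_of_le_sup {A M : Type*} [CommRing A] [AddCommGroup M] [Module A M]
    {U V W : Submodule A M} (h : U ≤ V ⊔ W) :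
    Module.length A U ≤ Module.length A V + Module.length A W :=
  (Module.length_le_of_injective _ (Submodule.inclusion_injective h)).trans (length_sup_le V W)

variable {R : Type*} [CommRing R] (𝒜 : ℕ → AddSubgroup R) [GradedRing 𝒜]

/-- The elements of an `ℕ`-graded ring all of whose components have degree at most `m`. -/
def ringFiltration (m : ℕ) : Submodule (𝒜 0) R := ⨆ i, ⨆ (_ : i ≤ m), ringPiece 𝒜 i

theorem ringPiece_le_ringFiltration {i m : ℕ} (h : i ≤ m) :
    ringPiece 𝒜 i ≤ ringFiltration 𝒜 m :=
  le_iSup₂_of_le i h le_rfl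

theorem ringFiltration_mono {m m' : ℕ} (h : m ≤ m') :
    ringFiltration 𝒜 m ≤ ringFiltration 𝒜 m' :=
  iSup₂_le fun _ hi => ringPiece_le_ringFiltration 𝒜 (hi.trans h)

theorem ringFiltration_succ_le (m : ℕ) :
    ringFiltration 𝒜 (m + 1) ≤ ringFiltration 𝒜 m ⊔ ringPiece 𝒜 (m + 1) := by
  refine iSup₂_le fun i hi => ?_
  rcases Nat.le_succ_iff.1 hi with h | rfl
  · exact le_sup_of_le_left (ringPiece_le_ringFiltration 𝒜 h)
  · exact le_sup_right

theorem mul_mem_ringFiltration {m m' : ℕ} {x y : R} (hx : x ∈ ringFiltration 𝒜 m)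
    (hy : y ∈ ringFiltration 𝒜 m') : x * y ∈ ringFiltration 𝒜 (m + m') := by
  have h : ringFiltration 𝒜 m * ringFiltration 𝒜 m' ≤ ringFiltration 𝒜 (m + m') := by
    rw [ringFiltration, ringFiltration]
    simp only [Submodule.iSup_mul, Submodule.mul_iSup, iSup_le_iff]
    intro i hi j hj
    refine Submodule.mul_le.2 fun a ha b hb => ?_
    exact ringPiece_le_ringFiltration 𝒜 (add_le_add hj hi)
      (SetLike.GradedMul.mul_mem (A := 𝒜) ha hb)
  exact h (Submodule.mul_mem_mul hx hy)

theorem one_mem_ringFiltration : (1 : R) ∈ ringFiltration 𝒜 0 :=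
  ringPiece_le_ringFiltration 𝒜 le_rfl (SetLike.GradedOne.one_mem (A := 𝒜))

theorem pow_mem_ringFiltration {m : ℕ} {x : R} (hx : x ∈ ringFiltration 𝒜 m) (n : ℕ) :
    x ^ n ∈ ringFiltration 𝒜 (n * m) := by
  induction n with
  | zero =>
    rw [pow_zero, zero_mul]
    exact one_mem_ringFiltration 𝒜
  | succ n ih =>
    rw [pow_succ, Nat.succ_mul]
    exact mul_mem_ringFiltration 𝒜 ih hx

theorem prod_mem_ringFiltration {σ : Type*} (T : Finset σ) {m : σ → ℕ} {x : σ → R}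
    (hx : ∀ j ∈ T, x j ∈ ringFiltration 𝒜 (m j)) :
    ∏ j ∈ T, x j ∈ ringFiltration 𝒜 (∑ j ∈ T, m j) := by
  classical
  induction T using Finset.induction_on with
  | empty => exact one_mem_ringFiltration 𝒜
  | insert a T ha ih =>
    rw [Finset.prod_insert ha, Finset.sum_insert ha]
    exact mul_mem_ringFiltration 𝒜 (hx a (by simp)) (ih fun j hj => hx j (by simp [hj]))

theorem exists_mem_ringFiltration (x : R) : ∃ m, x ∈ ringFiltration 𝒜 m := by
  classical
  obtain ⟨m, hm⟩ := (DFinsupp.support (decompose 𝒜 x)).exists_le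
  refine ⟨m, ?_⟩
  rw [← sum_support_decompose 𝒜 x]
  exact sum_mem fun n hn => ringPiece_le_ringFiltration 𝒜 (hm n hn) (decompose 𝒜 x n).2

variable [IsNoetherianRing R] [IsArtinianRing (𝒜 0)]

theorem length_map_ringFiltration_le (𝔮 : Ideal R) (m : ℕ) :
    Module.length (𝒜 0) ((ringFiltration 𝒜 m).map (𝔮.mkQ.restrictScalars (𝒜 0))) ≤
      ((∑ i ∈ Finset.range (m + 1),
        (Module.length (𝒜 0) (quotGrading (ringGrading 𝒜) 𝔮 i)).toNat : ℕ) : ℕ∞) := by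
  have hpiece : ∀ i : ℕ,
      Module.length (𝒜 0) ((ringPiece 𝒜 i).map (𝔮.mkQ.restrictScalars (𝒜 0))) =
        ((Module.length (𝒜 0) (quotGrading (ringGrading 𝒜) 𝔮 i)).toNat : ℕ∞) := fun i =>
    coe_quotHilb (ringGrading 𝒜) (L := 𝔮) (n := (i : ℤ)) (length_ringGrading_ne_top 𝒜 i)
  induction m with
  | zero =>
    have h : ringFiltration 𝒜 0 ≤ ringPiece 𝒜 0 := by
      refine iSup₂_le fun i hi => ?_
      rw [Nat.le_zero.1 hi]
    rw [zero_add, Finset.sum_range_one, ← hpiece 0]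
    exact Module.length_le_of_injective _ (Submodule.inclusion_injective (Submodule.map_mono h))
  | succ m ih =>
    have h := Submodule.map_mono (f := 𝔮.mkQ.restrictScalars (𝒜 0)) (ringFiltration_succ_le 𝒜 m)
    rw [Submodule.map_sup] at h
    refine (length_le_of_le_sup h).trans ?_
    rw [hpiece (m + 1), Finset.sum_range_succ, Nat.cast_add]
    exact add_le_add_left ih _

variable [IsLocalRing (𝒜 0)]

/-- If `R / 𝔮` contains a polynomial ring in `c` variables over the residue field of `R₀`, then its
Hilbert function, summed up to `E N`, is at least `(N + 1) ^ c`, the number of monomials with all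
exponents at most `N`. -/
theorem exists_pow_le_sum_quotHilb (𝔮 : Ideal R) {σ : Type*} [Fintype σ]
    (φ : MvPolynomial σ (IsLocalRing.ResidueField (𝒜 0)) →ₐ[𝒜 0] R ⧸ 𝔮)
    (hφ : Function.Injective φ) :
    ∃ E : ℕ, ∀ N : ℕ, ((N : ℤ) + 1) ^ Fintype.card σ ≤
      ∑ i ∈ Finset.range (E * N + 1), quotHilb (ringGrading 𝒜) 𝔮 i := by
  classical
  set k := IsLocalRing.ResidueField (𝒜 0)
  choose u hu using fun j : σ => Ideal.Quotient.mk_surjective (φ (MvPolynomial.X j))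
  choose D hD using fun j : σ => exists_mem_ringFiltration 𝒜 (u j)
  refine ⟨∑ j, D j, fun N => ?_⟩
  set m := (∑ j, D j) * N with hm
  set W := (ringFiltration 𝒜 m).map (𝔮.mkQ.restrictScalars (𝒜 0)) with hW
  let v : (σ → Fin (N + 1)) → MvPolynomial σ k := fun α => ∏ j, MvPolynomial.X j ^ (α j : ℕ)
  have hv : LinearIndependent k v := by
    have h1 := (MvPolynomial.basisMonomials σ k).linearIndependent.comp
      (fun α : σ → Fin (N + 1) => Finsupp.equivFunOnFinite.symm fun j => (α j : ℕ)) (by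
        intro α β h
        funext j
        exact Fin.ext (congrFun (Finsupp.equivFunOnFinite.symm.injective h) j))
    have h2 : v = MvPolynomial.basisMonomials σ k ∘
        fun α : σ → Fin (N + 1) => Finsupp.equivFunOnFinite.symm fun j => (α j : ℕ) := by
      funext α
      simp only [v, Function.comp_apply, MvPolynomial.coe_basisMonomials]
      rw [MvPolynomial.monomial_eq, map_one, one_mul, Finsupp.prod_fintype _ _ (by simp)]
      rfl
    rw [h2]
    exact h1
  have hvW : ∀ α, φ (v α) ∈ W := by
    intro α
    refine ⟨∏ j, u j ^ (α j : ℕ), ?_, ?_⟩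
    · refine ringFiltration_mono 𝒜 ?_
        (prod_mem_ringFiltration 𝒜 _ fun j _ => pow_mem_ringFiltration 𝒜 (hD j) (α j))
      rw [hm, Finset.sum_mul]
      refine Finset.sum_le_sum fun j _ => ?_
      rw [mul_comm]
      exact Nat.mul_le_mul_left _ (Nat.le_of_lt_succ (α j).2)
    · change Ideal.Quotient.mk 𝔮 (∏ j, u j ^ (α j : ℕ)) = φ (v α)
      rw [map_prod, map_prod]
      refine Finset.prod_congr rfl fun j _ => ?_
      rw [map_pow, map_pow, hu]
  let Φ : ((σ → Fin (N + 1)) → k) →ₗ[𝒜 0] R ⧸ 𝔮 :=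
    φ.toLinearMap ∘ₗ (Fintype.linearCombination k v).restrictScalars (𝒜 0)
  have hΦinj : Function.Injective Φ :=
    hφ.comp (linearIndependent_iff_injective_fintypeLinearCombination.1 hv)
  have hΦW : ∀ c, Φ c ∈ W := by
    intro c
    change φ (Fintype.linearCombination k v c) ∈ W
    rw [Fintype.linearCombination_apply, map_sum]
    refine sum_mem fun α _ => ?_
    obtain ⟨a, ha⟩ := IsLocalRing.residue_surjective (R := 𝒜 0) (c α)
    have h1 : c α • v α = a • v α := by
      rw [← ha, ← algebraMap_smul k a (v α)]
      rfl
    rw [h1, map_smul]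
    exact W.smul_mem a (hvW α)
  have h1 : Module.length (𝒜 0) ((σ → Fin (N + 1)) → k) = ((N + 1) ^ Fintype.card σ : ℕ) := by
    rw [Module.length_pi_of_fintype, Finset.sum_const,
      Module.length_eq_of_surjective (S := 𝒜 0) (R := k) (M := k) IsLocalRing.residue_surjective,
      Module.length_eq_one]
    simp
  have hinj : Function.Injective (Φ.codRestrict W hΦW) :=
    fun x y h => hΦinj (congrArg Subtype.val h)
  have h2 : Module.length (𝒜 0) ((σ → Fin (N + 1)) → k) ≤ Module.length (𝒜 0) W := by
    refine Module.length_le_of_injective (Φ.codRestrict W hΦW) ?_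
    exact hinj
  have h3 := h2.trans (length_map_ringFiltration_le 𝒜 𝔮 m)
  rw [h1, Nat.cast_le] at h3
  have h4 : (((N + 1) ^ Fintype.card σ : ℕ) : ℤ) ≤ _ := Nat.cast_le.2 h3
  push_cast at h4
  exact h4

/-- If `R / 𝔮` contains a polynomial ring in more than `s` variables, then its Hilbert function is
not bounded by a polynomial of degree less than `s`. -/
theorem not_quotHilb_le_of_isNumPoly (𝔮 : Ideal R) {σ : Type*} [Fintype σ]
    (φ : MvPolynomial σ (IsLocalRing.ResidueField (𝒜 0)) →ₐ[𝒜 0] R ⧸ 𝔮)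
    (hφ : Function.Injective φ) {s : ℕ} (hσ : s + 1 ≤ Fintype.card σ) {f : ℤ → ℤ}
    (hf : IsNumPoly s f) : ¬ ∀ n : ℕ, quotHilb (ringGrading 𝒜) 𝔮 n ≤ f n := by
  intro hle
  obtain ⟨E, hE⟩ := exists_pow_le_sum_quotHilb 𝒜 𝔮 φ hφ
  let F : ℤ → ℤ := fun n => ∑ i ∈ Finset.range (n.toNat + 1), f i
  have hF : IsNumPoly (s + 1) F := by
    rw [isNumPoly_succ_iff]
    refine hf.congr ?_
    filter_upwards [eventually_ge_atTop 1] with n hn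
    obtain ⟨m, rfl⟩ : ∃ m : ℕ, n = m + 1 := ⟨(n - 1).toNat, by omega⟩
    have h1 : ((m : ℤ) + 1).toNat = m + 1 := by omega
    rw [bwdDiff_apply, add_sub_cancel_right]
    simp only [F]
    rw [h1, Int.toNat_natCast, Finset.sum_range_succ _ (m + 1)]
    push_cast
    ring
  obtain ⟨C, hC, hbound⟩ := hF.exists_abs_le
  have key : ∀ N : ℕ, (N : ℤ) + 1 ≤ C * (E + 1) ^ s := by
    intro N
    have hpos : (0 : ℤ) < ((N : ℤ) + 1) ^ s := by positivity
    have h1 : ((N : ℤ) + 1) ^ (s + 1) ≤ ((N : ℤ) + 1) ^ Fintype.card σ :=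
      pow_le_pow_right₀ (by omega) hσ
    have h2 : ∑ i ∈ Finset.range (E * N + 1), quotHilb (ringGrading 𝒜) 𝔮 i ≤ F (E * N : ℕ) :=
      Finset.sum_le_sum fun i _ => hle i
    have h3 := (le_abs_self _).trans (hbound (E * N))
    have h4 : (((E * N : ℕ) : ℤ) + 1) ^ s ≤ (((E : ℤ) + 1) * (N + 1)) ^ s := by
      refine pow_le_pow_left₀ (by positivity) ?_ s
      push_cast
      nlinarith
    have h5 : ((N : ℤ) + 1) * ((N : ℤ) + 1) ^ s ≤ C * (E + 1) ^ s * ((N : ℤ) + 1) ^ s := by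
      rw [← pow_succ', mul_assoc, ← mul_pow]
      exact h1.trans ((hE N).trans (h2.trans (h3.trans (mul_le_mul_of_nonneg_left h4 hC))))
    exact le_of_mul_le_mul_right h5 hpos
  have := key (C * (E + 1) ^ s).toNat
  omega

end Growth

/-! ### Saturation with respect to a prime -/

section Saturation

variable {R M : Type*} [CommRing R] [AddCommGroup M] [Module R M] (𝔭 : Ideal R)

/-- `N` is saturated with respect to the prime `𝔭` if `M / N` is torsion-free over `R ∖ 𝔭`. -/
def IsSaturatedAt (N : Submodule R M) : Prop :=
  ∀ s ∉ 𝔭, ∀ m, s • m ∈ N → m ∈ N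

variable [h𝔭 : 𝔭.IsPrime]

/-- The kernel of `M → (M / N)_𝔭`, that is, the smallest submodule containing `N` that is saturated
with respect to `𝔭`. -/
def saturationAt (N : Submodule R M) : Submodule R M where
  carrier := {m | ∃ s ∉ 𝔭, s • m ∈ N}
  add_mem' := by
    rintro m m' ⟨s, hs, hm⟩ ⟨s', hs', hm'⟩
    refine ⟨s * s', fun h => (h𝔭.mem_or_mem h).elim hs hs', ?_⟩
    rw [smul_add, mul_smul, mul_smul, smul_comm s s' m]
    exact N.add_mem (N.smul_mem _ hm) (N.smul_mem _ hm')
  zero_mem' := ⟨1, fun h => h𝔭.ne_top ((Ideal.eq_top_iff_one 𝔭).2 h), by simp⟩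
  smul_mem' := by
    rintro r m ⟨s, hs, hm⟩
    exact ⟨s, hs, by rw [smul_comm]; exact N.smul_mem r hm⟩

variable {𝔭}

theorem mem_saturationAt {N : Submodule R M} {m : M} :
    m ∈ saturationAt 𝔭 N ↔ ∃ s ∉ 𝔭, s • m ∈ N := Iff.rfl

theorem le_saturationAt (N : Submodule R M) : N ≤ saturationAt 𝔭 N :=
  fun m hm => ⟨1, fun h => h𝔭.ne_top ((Ideal.eq_top_iff_one 𝔭).2 h), by rwa [one_smul]⟩

theorem isSaturatedAt_saturationAt (N : Submodule R M) : IsSaturatedAt 𝔭 (saturationAt 𝔭 N) := by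
  rintro s hs m ⟨s', hs', hm⟩
  refine ⟨s' * s, fun h => (h𝔭.mem_or_mem h).elim hs' hs, ?_⟩
  rwa [mul_smul]

/-- A single element outside `𝔭` multiplies all of the saturation of `N` into `N`. -/
theorem exists_smul_le_of_fg [IsNoetherian R M] (N : Submodule R M) :
    ∃ s ∉ 𝔭, ∀ m ∈ saturationAt 𝔭 N, s • m ∈ N := by
  obtain ⟨T, hT⟩ := IsNoetherian.noetherian (saturationAt 𝔭 N)
  have hmem : ∀ m ∈ T, ∃ s ∉ 𝔭, s • m ∈ N := fun m hm =>
    mem_saturationAt.1 (hT ▸ Submodule.subset_span hm)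
  choose! s hs hsm using hmem
  refine ⟨∏ m ∈ T, s m, fun h => ?_, fun m hm => ?_⟩
  · obtain ⟨m, hm, h'⟩ := h𝔭.prod_mem_iff.1 h
    exact hs m hm h'
  · rw [← hT] at hm
    induction hm using Submodule.span_induction with
    | mem m hm =>
      classical
      rw [← Finset.prod_erase_mul T s hm, mul_smul]
      exact N.smul_mem _ (hsm m hm)
    | zero => simp
    | add x y _ _ hx hy =>
      rw [smul_add]
      exact N.add_mem hx hy
    | smul r x _ hx =>
      rw [smul_comm]
      exact N.smul_mem r hx

end Saturation

section SaturationHomogeneous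

variable {A R M : Type*} [CommRing A] [CommRing R] [Algebra A R] [AddCommGroup M] [Module A M]
  [Module R M] [IsScalarTower A R M] {ℛ : ℤ → Submodule A R} [GradedRing ℛ]
  {ℳ : ℤ → Submodule A M} [Decomposition ℳ]

omit [IsScalarTower A R M] in
theorem homComp_smul_eq_zero_of_lt (hsm : ∀ i j, ∀ a ∈ ℛ i, ∀ x ∈ ℳ j, a • x ∈ ℳ (i + j)) {k l : ℤ}
    {a : R} {m : M} (ha : ∀ i > k, homComp ℛ i a = 0) (hm : ∀ i > l, homComp ℳ i m = 0) {n : ℤ}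
    (hn : n > k + l) : homComp ℳ n (a • m) = 0 := by
  obtain ⟨S, hS⟩ := exists_finset_sum_homComp ℛ a
  rw [← hS, Finset.sum_smul, map_sum]
  refine Finset.sum_eq_zero fun i _ => ?_
  rw [← sub_add_cancel n i, homComp_smul hsm (homComp_mem ℛ i a)]
  by_cases hi : i > k
  · rw [ha i hi, zero_smul]
  · rw [hm _ (by omega), smul_zero]

omit [IsScalarTower A R M] in
/-- The component of `a m` in the sum of the top degrees of `a` and `m` is the product of their top
components. -/
theorem homComp_smul_top (hsm : ∀ i j, ∀ a ∈ ℛ i, ∀ x ∈ ℳ j, a • x ∈ ℳ (i + j)) {k l : ℤ}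
    {a : R} {m : M} (ha : ∀ i > k, homComp ℛ i a = 0) (hm : ∀ i > l, homComp ℳ i m = 0) :
    homComp ℳ (k + l) (a • m) = homComp ℛ k a • homComp ℳ l m := by
  have h1 : a = (a - homComp ℛ k a) + homComp ℛ k a := by ring
  have h2 : ∀ i > k - 1, homComp ℛ i (a - homComp ℛ k a) = 0 := by
    intro i hi
    rw [map_sub]
    rcases eq_or_lt_of_le (show k ≤ i by omega) with rfl | hlt
    · rw [homComp_of_mem (homComp_mem ℛ k a), sub_self]
    · rw [ha i hlt, homComp_of_mem_ne (homComp_mem ℛ k a) hlt.ne, sub_self]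
  conv_lhs => rw [h1, add_smul, map_add, homComp_smul_eq_zero_of_lt hsm h2 hm (by omega), zero_add,
    add_comm k l, homComp_smul hsm (homComp_mem ℛ k a)]

variable (ℛ) in
/-- The homogeneous component of highest degree of `s` lies outside `𝔭`. -/
def HasTopOutside (𝔭 : Ideal R) (s : R) : Prop :=
  ∃ k, homComp ℛ k s ∉ 𝔭 ∧ ∀ i > k, homComp ℛ i s = 0

theorem HasTopOutside.mul {𝔭 : Ideal R} [h𝔭 : 𝔭.IsPrime] {s s' : R} (hs : HasTopOutside ℛ 𝔭 s)
    (hs' : HasTopOutside ℛ 𝔭 s') : HasTopOutside ℛ 𝔭 (s * s') := by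
  obtain ⟨k, hk, hk'⟩ := hs
  obtain ⟨l, hl, hl'⟩ := hs'
  have hsm : ∀ i j, ∀ a ∈ ℛ i, ∀ x ∈ ℛ j, a • x ∈ ℛ (i + j) :=
    fun i j a ha x hx => SetLike.GradedMul.mul_mem ha hx
  refine ⟨k + l, ?_, fun i hi => homComp_smul_eq_zero_of_lt hsm hk' hl' hi⟩
  rw [← smul_eq_mul, homComp_smul_top hsm hk' hl', smul_eq_mul]
  exact fun h => (h𝔭.mem_or_mem h).elim hk hl

theorem HasTopOutside.pow {𝔭 : Ideal R} [h𝔭 : 𝔭.IsPrime] {s : R} (hs : HasTopOutside ℛ 𝔭 s)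
    (n : ℕ) : HasTopOutside ℛ 𝔭 (s ^ n) := by
  induction n with
  | zero =>
    have h1 : (1 : R) ∈ ℛ 0 := SetLike.GradedOne.one_mem
    rw [pow_zero]
    refine ⟨0, ?_, fun i hi => homComp_of_mem_ne h1 hi.ne⟩
    rw [homComp_of_mem h1]
    exact fun h => h𝔭.ne_top ((Ideal.eq_top_iff_one 𝔭).2 h)
  | succ n ih =>
    rw [pow_succ]
    exact ih.mul hs

/-- Every `s ∉ 𝔭` has a multiple whose top component lies outside `𝔭`, if `𝔭` is a nil ideal: drop
from `s` its components in `𝔭`; some power of the result is divisible by `s`. -/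
theorem exists_hasTopOutside_mul {𝔭 : Ideal R} [h𝔭 : 𝔭.IsPrime] (hnil : ∀ p ∈ 𝔭, IsNilpotent p)
    {s : R} (hs : s ∉ 𝔭) : ∃ u, HasTopOutside ℛ 𝔭 (u * s) := by
  classical
  obtain ⟨S, hS⟩ := exists_finset_sum_homComp ℛ s
  set T := S.filter fun i => homComp ℛ i s ∉ 𝔭
  set s' := ∑ i ∈ T, homComp ℛ i s with hs'
  have hcomp : ∀ n, homComp ℛ n s' = if n ∈ T then homComp ℛ n s else 0 := by
    intro n
    rw [hs', map_sum]
    split_ifs with hn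
    · rw [Finset.sum_eq_single n]
      · exact homComp_of_mem (homComp_mem ℛ n s)
      · exact fun i _ hi => homComp_of_mem_ne (homComp_mem ℛ i s) hi
      · exact fun h => absurd hn h
    · exact Finset.sum_eq_zero fun i hi =>
        homComp_of_mem_ne (homComp_mem ℛ i s) fun h => hn (h ▸ hi)
  have hdiff : s - s' ∈ 𝔭 := by
    have h1 := Finset.sum_filter_add_sum_filter_not S (fun i => homComp ℛ i s ∉ 𝔭)
      fun i => homComp ℛ i s
    rw [hS] at h1
    rw [sub_eq_of_eq_add' h1.symm]
    exact sum_mem fun i hi => not_not.1 (Finset.mem_filter.1 hi).2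
  have hTne : T.Nonempty := by
    by_contra h
    rw [Finset.not_nonempty_iff_eq_empty] at h
    rw [hs', h, Finset.sum_empty, sub_zero] at hdiff
    exact hs hdiff
  have htop : HasTopOutside ℛ 𝔭 s' := by
    refine ⟨T.max' hTne, ?_, fun i hi => ?_⟩
    · rw [hcomp, if_pos (T.max'_mem hTne)]
      exact (Finset.mem_filter.1 (T.max'_mem hTne)).2
    · rw [hcomp, if_neg fun h => absurd (T.le_max' i h) (not_le.2 hi)]
  obtain ⟨K, hK⟩ := hnil _ (𝔭.neg_mem hdiff)
  have hdvd : s ∣ s' ^ K := by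
    have := sub_dvd_pow_sub_pow s' (-(s - s')) K
    rw [hK, sub_zero] at this
    simpa using this
  obtain ⟨u, hu⟩ := hdvd
  exact ⟨u, by rw [mul_comm, ← hu]; exact htop.pow K⟩

omit [IsScalarTower A R M] in
/-- If `s m ∈ N` with the top component of `s` outside `𝔭`, then all components of `m` lie in the
saturation of `N`. By induction on the degrees occurring in `m`: the top component of `s` multiplies
that of `m` into `N`, which allows splitting the latter off. -/
theorem homComp_mem_saturationAt (hsm : ∀ i j, ∀ a ∈ ℛ i, ∀ x ∈ ℳ j, a • x ∈ ℳ (i + j))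
    {𝔭 : Ideal R} [h𝔭 : 𝔭.IsPrime] {N : Submodule R M} (hN : N.IsHomogeneous ℳ) (S : Finset ℤ)
    {s : R} (hs : HasTopOutside ℛ 𝔭 s) {m : M} (hm : ∀ i ∉ S, homComp ℳ i m = 0)
    (hsN : s • m ∈ N) (n : ℤ) : homComp ℳ n m ∈ saturationAt 𝔭 N := by
  induction S using Finset.induction_on_max generalizing s m with
  | empty =>
    rw [hm n (by simp)]
    exact zero_mem _
  | insert j S hj ih =>
    obtain ⟨k, hk, hk'⟩ := hs
    have hjS : j ∉ S := fun h => lt_irrefl j (hj j h)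
    have h1 : homComp ℛ k s • homComp ℳ j m ∈ N := by
      rw [← homComp_smul_top hsm hk' fun i hi => hm i fun h => ?_]
      · exact isHomogeneous_iff.1 hN _ _ hsN
      · rcases Finset.mem_insert.1 h with rfl | h
        · exact lt_irrefl _ hi
        · exact lt_asymm hi (hj i h)
    by_cases hn : n = j
    · rw [hn]
      exact ⟨_, hk, h1⟩
    · have htop : HasTopOutside ℛ 𝔭 (homComp ℛ k s) := by
        refine ⟨k, ?_, fun i hi => homComp_of_mem_ne (homComp_mem ℛ k s) hi.ne⟩
        rwa [homComp_of_mem (homComp_mem ℛ k s)]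
      have h2 := ih (htop.mul ⟨k, hk, hk'⟩) (m := m - homComp ℳ j m) ?_ ?_
      · rwa [map_sub, homComp_of_mem_ne (homComp_mem ℳ j m) (Ne.symm hn), sub_zero] at h2
      · intro i hi
        rw [map_sub]
        by_cases hij : i = j
        · rw [hij, homComp_of_mem (homComp_mem ℳ j m), sub_self]
        · rw [hm i (by simp [hij, hi]), homComp_of_mem_ne (homComp_mem ℳ j m) (Ne.symm hij),
            sub_zero]
      · rw [smul_sub, mul_smul, mul_comm, mul_smul]
        exact N.sub_mem (N.smul_mem _ hsN) (N.smul_mem _ h1)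

omit [IsScalarTower A R M] in
theorem isHomogeneous_saturationAt (hsm : ∀ i j, ∀ a ∈ ℛ i, ∀ x ∈ ℳ j, a • x ∈ ℳ (i + j))
    {𝔭 : Ideal R} [h𝔭 : 𝔭.IsPrime] (hnil : ∀ p ∈ 𝔭, IsNilpotent p) {N : Submodule R M}
    (hN : N.IsHomogeneous ℳ) : (saturationAt 𝔭 N).IsHomogeneous ℳ := by
  classical
  refine isHomogeneous_iff.2 fun n m ⟨s, hs, hm⟩ => ?_
  obtain ⟨u, hu⟩ := exists_hasTopOutside_mul (ℛ := ℛ) hnil hs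
  refine homComp_mem_saturationAt hsm hN (DFinsupp.support (decompose ℳ m)) hu (fun i hi => ?_)
    (by rw [mul_smul]; exact N.smul_mem u hm) n
  rw [DFinsupp.notMem_support_iff] at hi
  rw [homComp_apply, hi, ZeroMemClass.coe_zero]

end SaturationHomogeneous

/-! ### The filtration with factors generically of rank one -/

section Chain

variable {A R M : Type*} [CommRing A] [CommRing R] [Algebra A R] [AddCommGroup M] [Module A M]
  [Module R M] {ℛ : ℤ → Submodule A R} [GradedRing ℛ]
  {ℳ : ℤ → Submodule A M} [Decomposition ℳ]

omit [GradedRing ℛ] [Decomposition ℳ] in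
/-- If `𝔭` is generated by nilpotent elements of degree zero and `M` is generated in degree `t`,
then modulo any saturated `N ≠ M` some element of `M_t` has annihilator `𝔭`. -/
theorem exists_colonElem_eq [IsNoetherianRing R]
    (hsm : ∀ i j, ∀ a ∈ ℛ i, ∀ x ∈ ℳ j, a • x ∈ ℳ (i + j)) {𝔭 : Ideal R} {G : Set R}
    (hG : G ⊆ ℛ 0) (h𝔭 : 𝔭 = Ideal.span G) (hnil : ∀ p ∈ 𝔭, IsNilpotent p) {t : ℤ}
    (hgen : Submodule.span R (ℳ t : Set M) = ⊤) {N : Submodule R M} (hsat : IsSaturatedAt 𝔭 N)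
    (hne : N ≠ ⊤) : ∃ x ∈ ℳ t, colonElem N x = 𝔭 := by
  let S : Set (Ideal R) := {I | ∃ x ∈ ℳ t, x ∉ N ∧ colonElem N x = I}
  have hS : S.Nonempty := by
    by_contra h
    refine hne (top_le_iff.1 ?_)
    rw [← hgen, Submodule.span_le]
    intro x hx
    by_contra hxN
    exact h ⟨_, x, hx, hxN, rfl⟩
  obtain ⟨I, ⟨x, hx, hxN, rfl⟩, hmax⟩ := set_has_maximal_iff_noetherian.2 ‹_› S hS
  refine ⟨x, hx, le_antisymm (fun r hr => ?_) ?_⟩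
  · by_contra hr𝔭
    exact hxN (hsat r hr𝔭 x hr)
  · rw [h𝔭, Ideal.span_le]
    intro a ha
    by_contra hax
    -- By maximality of `(N : x)`, multiplying by `a` never leads from `M_t ∖ N` into `N`, which
    -- contradicts the nilpotency of `a`.
    have hpow : ∀ j : ℕ, a ^ j • x ∈ ℳ t ∧ a ^ j • x ∉ N := by
      intro j
      induction j with
      | zero => simpa using ⟨hx, hxN⟩
      | succ j ih =>
        rw [pow_succ', mul_smul]
        refine ⟨by simpa using hsm 0 t a (hG ha) _ ih.1, fun h => hax ?_⟩
        have hle : colonElem N x ≤ colonElem N (a ^ j • x) := fun r hr => by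
          rw [mem_colonElem, smul_comm]
          exact N.smul_mem _ hr
        have heq : colonElem N (a ^ j • x) ≤ colonElem N x := by
          by_contra hc
          exact hmax _ ⟨_, ih.1, ih.2, rfl⟩ (lt_of_le_not_ge hle hc)
        exact heq h
    obtain ⟨K, hK⟩ := hnil a (h𝔭 ▸ Ideal.subset_span ha)
    apply (hpow K).2
    rw [hK, zero_smul]
    exact N.zero_mem

/-- There is a chain `N = L₀ ⊂ L₁ ⊂ ⋯ ⊂ L_r = M` of saturated homogeneous submodules such that
`L_{i + 1} / L_i` is, up to torsion over `R / 𝔭`, a copy of `(R / 𝔭)(-t)`. -/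
theorem exists_saturated_chain [IsNoetherianRing R] [IsNoetherian R M]
    (hsm : ∀ i j, ∀ a ∈ ℛ i, ∀ x ∈ ℳ j, a • x ∈ ℳ (i + j)) {𝔭 : Ideal R} [𝔭.IsPrime] {G : Set R}
    (hG : G ⊆ ℛ 0) (h𝔭 : 𝔭 = Ideal.span G) (hnil : ∀ p ∈ 𝔭, IsNilpotent p) {t : ℤ}
    (hgen : Submodule.span R (ℳ t : Set M) = ⊤) (N : Submodule R M) (hN : N.IsHomogeneous ℳ)
    (hsat : IsSaturatedAt 𝔭 N) :
    ∃ (r : ℕ) (L : ℕ → Submodule R M) (x : ℕ → M), L 0 = N ∧ L r = ⊤ ∧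
      (∀ i, (L i).IsHomogeneous ℳ ∧ IsSaturatedAt 𝔭 (L i)) ∧
      ∀ i < r, x i ∈ ℳ t ∧ colonElem (L i) (x i) = 𝔭 ∧
        L (i + 1) = saturationAt 𝔭 (L i ⊔ Submodule.span R {x i}) := by
  induction N using IsNoetherian.induction with
  | hgt N ih =>
    by_cases hne : N = ⊤
    · exact ⟨0, fun _ => N, fun _ => 0, rfl, hne, fun _ => ⟨hN, hsat⟩, by simp⟩
    · obtain ⟨x₀, hx₀, hcolon⟩ := exists_colonElem_eq hsm hG h𝔭 hnil hgen hsat hne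
      set N' := saturationAt 𝔭 (N ⊔ Submodule.span R {x₀}) with hN'
      have hx₀N' : x₀ ∈ N' := le_saturationAt _
        (Submodule.mem_sup_right (Submodule.mem_span_singleton_self x₀))
      have hx₀N : x₀ ∉ N := fun h => by
        have h1 : (1 : R) ∈ colonElem N x₀ := by rwa [mem_colonElem, one_smul]
        rw [hcolon] at h1
        exact (inferInstance : 𝔭.IsPrime).ne_top ((Ideal.eq_top_iff_one 𝔭).2 h1)
      have hlt : N < N' := lt_of_le_of_ne (le_sup_left.trans (le_saturationAt _))
        fun h => hx₀N (h ▸ hx₀N')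
      obtain ⟨r, L, x, h0, hr, hL, hx⟩ := ih N' hlt
        (isHomogeneous_saturationAt hsm hnil (isHomogeneous_sup_span hsm hN hx₀))
        (isSaturatedAt_saturationAt _)
      refine ⟨r + 1, fun i => Nat.casesOn i N L, fun i => Nat.casesOn i x₀ x, rfl, hr, ?_, ?_⟩
      · rintro (_ | i)
        · exact ⟨hN, hsat⟩
        · exact hL i
      · rintro (_ | i) hi
        · exact ⟨hx₀, hcolon, h0⟩
        · exact hx i (by omega)

end Chain

/-! ### The chain localized at `𝔭` -/

section Localization

variable {R M : Type*} [CommRing R] [AddCommGroup M] [Module R M] {𝔭 : Ideal R} [h𝔭 : 𝔭.IsPrime]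

theorem mk_mem_localized_iff {L : Submodule R M} (hL : IsSaturatedAt 𝔭 L) {m : M}
    {s : 𝔭.primeCompl} : LocalizedModule.mk m s ∈ L.localized 𝔭.primeCompl ↔ m ∈ L := by
  rw [Submodule.mem_localized']
  constructor
  · rintro ⟨n, hn, s', h⟩
    rw [← IsLocalizedModule.mk_eq_mk', LocalizedModule.mk_eq] at h
    obtain ⟨u, hu⟩ := h
    refine hL (u * s' : 𝔭.primeCompl) (u * s').2 m ?_
    have h2 : ((u * s' : 𝔭.primeCompl) : R) • m = (u : R) • (s : R) • n := by
      rw [Submonoid.coe_mul, mul_smul]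
      exact hu.symm
    rw [h2]
    exact L.smul_mem (u : R) (L.smul_mem (s : R) hn)
  · exact fun hm => ⟨m, hm, s, (IsLocalizedModule.mk_eq_mk' s m).symm⟩

theorem mk_mem_iff (c : Submodule (Localization 𝔭.primeCompl) (LocalizedModule 𝔭.primeCompl M))
    {m : M} {s : 𝔭.primeCompl} : LocalizedModule.mk m s ∈ c ↔ LocalizedModule.mk m 1 ∈ c := by
  constructor
  · intro h
    have := c.smul_mem (Localization.mk (s : R) 1) h
    rw [LocalizedModule.mk_smul_mk, one_mul] at this
    rwa [show LocalizedModule.mk ((s : R) • m) s = LocalizedModule.mk m 1 from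
      LocalizedModule.mk_cancel s m] at this
  · intro h
    have := c.smul_mem (Localization.mk 1 s) h
    rwa [LocalizedModule.mk_smul_mk, one_smul, mul_one] at this

theorem mk_smul_mem_iff (c : Submodule (Localization 𝔭.primeCompl) (LocalizedModule 𝔭.primeCompl M))
    {m : M} {r : R} (hr : r ∉ 𝔭) :
    LocalizedModule.mk (r • m) 1 ∈ c ↔ LocalizedModule.mk m 1 ∈ c := by
  rw [← mk_mem_iff c (s := ⟨r, hr⟩), show LocalizedModule.mk (r • m) ⟨r, hr⟩ =
    LocalizedModule.mk m (1 : 𝔭.primeCompl) from LocalizedModule.mk_cancel ⟨r, hr⟩ m]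

theorem mk_smul_mem (c : Submodule (Localization 𝔭.primeCompl) (LocalizedModule 𝔭.primeCompl M))
    {m : M} (r : R) (h : LocalizedModule.mk m (1 : 𝔭.primeCompl) ∈ c) :
    LocalizedModule.mk (r • m) (1 : 𝔭.primeCompl) ∈ c := by
  have := c.smul_mem (Localization.mk r 1) h
  rwa [LocalizedModule.mk_smul_mk, one_mul] at this

/-- The step from `L` to the saturation of `L + R x`, with `(L : x) = 𝔭`, has a simple factor after
localization at `𝔭`, namely `κ(𝔭)`. -/
theorem localized_covBy {L : Submodule R M} (hL : IsSaturatedAt 𝔭 L) {x : M}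
    (hx : colonElem L x = 𝔭) :
    L.localized 𝔭.primeCompl ⋖
      (saturationAt 𝔭 (L ⊔ Submodule.span R {x})).localized 𝔭.primeCompl := by
  set L' := saturationAt 𝔭 (L ⊔ Submodule.span R {x}) with hL'
  have hsat' : IsSaturatedAt 𝔭 L' := isSaturatedAt_saturationAt _
  have hLL' : L ≤ L' := le_sup_left.trans (le_saturationAt _)
  have hmem : ∀ m ∈ L', ∃ u ∉ 𝔭, ∃ n ∈ L, ∃ r : R, u • m = n + r • x := by
    rintro m ⟨u, hu, hm⟩
    obtain ⟨n, hn, w, hw, h⟩ := Submodule.mem_sup.1 hm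
    obtain ⟨r, rfl⟩ := Submodule.mem_span_singleton.1 hw
    exact ⟨u, hu, n, hn, r, h.symm⟩
  have hle : L.localized 𝔭.primeCompl ≤ L'.localized 𝔭.primeCompl := by
    intro z hz
    induction z using LocalizedModule.induction_on with
    | _ m s =>
      rw [mk_mem_localized_iff hL] at hz
      rw [mk_mem_localized_iff hsat']
      exact hLL' hz
  have hxL : x ∉ L := fun h => by
    have h1 : (1 : R) ∈ colonElem L x := by rwa [mem_colonElem, one_smul]
    rw [hx] at h1
    exact h𝔭.ne_top ((Ideal.eq_top_iff_one 𝔭).2 h1)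
  have hxL' : x ∈ L' :=
    le_saturationAt _ (Submodule.mem_sup_right (Submodule.mem_span_singleton_self x))
  refine ⟨lt_of_le_of_ne hle fun h => hxL ?_, fun c hc hc' => ?_⟩
  · rw [← mk_mem_localized_iff hL (s := 1), h, mk_mem_localized_iff hsat']
    exact hxL'
  · obtain ⟨z, hzc, hzL⟩ := Set.exists_of_ssubset
      (show (L.localized 𝔭.primeCompl : Set (LocalizedModule 𝔭.primeCompl M)) ⊂ c from hc)
    have hLc : ∀ n ∈ L, LocalizedModule.mk n (1 : 𝔭.primeCompl) ∈ c := fun n hn =>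
      hc.le ((mk_mem_localized_iff hL).2 hn)
    have hxc : LocalizedModule.mk x (1 : 𝔭.primeCompl) ∈ c := by
      induction z using LocalizedModule.induction_on with
      | _ m s =>
        have hmL' : m ∈ L' := (mk_mem_localized_iff hsat').1 (hc'.le hzc)
        have hmL : m ∉ L := fun h => hzL ((mk_mem_localized_iff hL).2 h)
        obtain ⟨u, hu, n, hn, r, h⟩ := hmem m hmL'
        have hr : r ∉ 𝔭 := by
          intro hr
          rw [← hx] at hr
          exact hmL (hL u hu m (h ▸ L.add_mem hn hr))
        rw [← mk_smul_mem_iff c hr, ← add_sub_cancel_left n (r • x), ← h,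
          ← mk_mem_iff c (s := 1)]
        have h1 := c.sub_mem (mk_smul_mem c u ((mk_mem_iff c).1 hzc)) (hLc n hn)
        have h2 : LocalizedModule.mk (u • m - n) (1 : 𝔭.primeCompl) =
            LocalizedModule.mk (u • m) 1 - LocalizedModule.mk n 1 :=
          map_sub (LocalizedModule.mkLinearMap 𝔭.primeCompl M) _ _
        rwa [h2]
    refine not_le_of_gt hc' fun y hy => ?_
    induction y using LocalizedModule.induction_on with
    | _ m s =>
      obtain ⟨u, hu, n, hn, r, h⟩ := hmem m ((mk_mem_localized_iff hsat').1 hy)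
      rw [mk_mem_iff, ← mk_smul_mem_iff c hu, h]
      have h1 := c.add_mem (hLc n hn) (mk_smul_mem c r hxc)
      have h2 : LocalizedModule.mk (n + r • x) (1 : 𝔭.primeCompl) =
          LocalizedModule.mk n 1 + LocalizedModule.mk (r • x) 1 :=
        map_add (LocalizedModule.mkLinearMap 𝔭.primeCompl M) _ _
      rwa [h2]

/-- Localized at `𝔭`, the chain of `exists_saturated_chain` becomes a composition series of
`M_𝔭`. -/
theorem length_localizedModule_eq {r : ℕ} {L : ℕ → Submodule R M} {x : ℕ → M} (h0 : L 0 = ⊥)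
    (hr : L r = ⊤) (hsat : ∀ i, IsSaturatedAt 𝔭 (L i))
    (hx : ∀ i < r, colonElem (L i) (x i) = 𝔭 ∧
      L (i + 1) = saturationAt 𝔭 (L i ⊔ Submodule.span R {x i})) :
    Module.length (Localization.AtPrime 𝔭) (LocalizedModule 𝔭.primeCompl M) = (r : ℕ∞) := by
  let s : CompositionSeries
      (Submodule (Localization.AtPrime 𝔭) (LocalizedModule 𝔭.primeCompl M)) :=
    { length := r
      toFun := fun i => (L i).localized 𝔭.primeCompl
      step := fun i => by
        have := localized_covBy (hsat i) (hx i i.2).1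
        rw [← (hx i i.2).2] at this
        exact this }
  refine (Module.length_compositionSeries s ?_ ?_).symm
  · change (L 0).localized 𝔭.primeCompl = ⊥
    rw [h0]
    exact Submodule.localized'_bot _ _ _
  · change (L r).localized 𝔭.primeCompl = ⊤
    rw [hr]
    exact Submodule.localized'_top _ _ _

end Localization

/-! ### Serre's condition `(S₂)` -/

section SerreTwo

theorem exists_regular_pair_of_two_le_localDepth {S : Type*} [CommRing S] [IsLocalRing S]
    (h : 2 ≤ localDepth S) : ∃ a ∈ IsLocalRing.maximalIdeal S, ∃ b ∈ IsLocalRing.maximalIdeal S,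
      (∀ c, a * c = 0 → c = 0) ∧ ∀ c, a ∣ b * c → a ∣ c := by
  obtain ⟨rs, hmem, hreg, hlen⟩ : ∃ rs : List S, (∀ r ∈ rs, r ∈ IsLocalRing.maximalIdeal S) ∧
      RingTheory.Sequence.IsRegular S rs ∧ 2 ≤ rs.length := by
    by_contra! hc
    have h1 : localDepth S ≤ 1 := iSup₂_le fun rs hrs => by
      have := hc rs hrs.1 hrs.2
      exact_mod_cast Nat.lt_succ_iff.1 this
    exact absurd (h.trans h1) (by decide)
  match rs, hmem, hreg, hlen with
  | a :: b :: rs, hmem, hreg, _ =>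
    have h1 := (RingTheory.Sequence.isWeaklyRegular_cons_iff S a (b :: rs)).1 hreg.1
    have h2 := (RingTheory.Sequence.isWeaklyRegular_cons_iff _ b rs).1 h1.2
    refine ⟨a, hmem a (by simp), b, hmem b (by simp), fun c hc => ?_, fun c ⟨u, hu⟩ => ?_⟩
    · exact h1.1 (show a • c = a • 0 by rw [smul_eq_mul, hc, smul_zero])
    · have h3 : b • (Submodule.Quotient.mk c : QuotSMulTop a S) = b • 0 := by
        rw [smul_zero, ← Submodule.Quotient.mk_smul, Submodule.Quotient.mk_eq_zero,
          Submodule.mem_smul_pointwise_iff_exists]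
        exact ⟨u, Submodule.mem_top, hu.symm⟩
      have h4 := h2.1 h3
      rw [Submodule.Quotient.mk_eq_zero, Submodule.mem_smul_pointwise_iff_exists] at h4
      obtain ⟨v, -, hv⟩ := h4
      exact ⟨v, hv.symm⟩

/-- Serre's condition `(S₂)` at a prime `Q` of height at least two, with denominators cleared: `Q`
contains elements `a ≠ 0` and `b` such that `b` is a nonzerodivisor modulo `a` locally at `Q`. -/
theorem SerreCondition.exists_pair {S : Type*} [CommRing S] (hS : SerreCondition S 2)
    (Q : Ideal S) [Q.IsPrime] (hht : 2 ≤ Q.height) :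
    ∃ a ∈ Q, ∃ b ∈ Q, a ≠ 0 ∧ ∀ c, a ∣ b * c → ∃ w ∉ Q, a ∣ w * c := by
  have h1 := hS Q
  rw [IsLocalization.AtPrime.ringKrullDim_eq_height Q (Localization.AtPrime Q)] at h1
  have h2 : (2 : ℕ∞) ≤ localDepth (Localization.AtPrime Q) := by
    have h3 : ((2 : ℕ∞) : WithBot ℕ∞) ≤ (Q.height : WithBot ℕ∞) := WithBot.coe_le_coe.2 hht
    have h4 : min ((2 : ℕ) : WithBot ℕ∞) (Q.height : WithBot ℕ∞) = ((2 : ℕ∞) : WithBot ℕ∞) :=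
      min_eq_left h3
    rw [h4] at h1
    exact WithBot.coe_le_coe.1 h1
  obtain ⟨α, hα, β, hβ, hreg, hreg'⟩ := exists_regular_pair_of_two_le_localDepth h2
  obtain ⟨a, s, rfl⟩ := IsLocalization.exists_mk'_eq Q.primeCompl α
  obtain ⟨b, s', rfl⟩ := IsLocalization.exists_mk'_eq Q.primeCompl β
  have hmem : ∀ (r : S) (u : Q.primeCompl), IsLocalization.mk' (Localization.AtPrime Q) r u ∈
      IsLocalRing.maximalIdeal (Localization.AtPrime Q) → r ∈ Q := fun r u h =>
    (IsLocalization.AtPrime.mk'_mem_maximal_iff (Localization.AtPrime Q) Q r u).1 h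
  refine ⟨a, hmem a s hα, b, hmem b s' hβ, ?_, fun c ⟨v, hv⟩ => ?_⟩
  · rintro rfl
    rw [IsLocalization.mk'_zero] at hreg
    exact one_ne_zero (hreg 1 (zero_mul 1))
  · obtain ⟨z, hz⟩ := hreg' (IsLocalization.mk' (Localization.AtPrime Q) c 1) (by
      refine ⟨IsLocalization.mk' (Localization.AtPrime Q) (s * v) s', ?_⟩
      rw [← IsLocalization.mk'_mul, ← IsLocalization.mk'_mul, hv, IsLocalization.mk'_eq_iff_eq]
      congr 1
      push_cast
      ring)
    obtain ⟨e, f, rfl⟩ := IsLocalization.exists_mk'_eq Q.primeCompl z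
    rw [← IsLocalization.mk'_mul, IsLocalization.mk'_eq_iff_eq, IsLocalization.eq_iff_exists
      Q.primeCompl] at hz
    obtain ⟨w, hw⟩ := hz
    refine ⟨w * (s * f), (w * (s * f)).2, w * e, ?_⟩
    push_cast at hw ⊢
    linear_combination hw

/-- Let `R / 𝔭` satisfy `(S₂)`, let `M / N` be torsion-free over `R ∖ 𝔭`, and let `x` span modulo `N`
a copy of `R / 𝔭`. Then no prime `𝔮` with `𝔮 / 𝔭` of height at least two is associated to
`M / (N + R x)`: if `𝔮 y ⊆ N + R x` and `a, b` is a regular sequence in `𝔮` locally, then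
`a y = s x` and `b y = s' x` modulo `N` force `b s = a s'`, so `a ∣ s` and `y ∈ N + R x`, locally. -/
theorem height_map_lt_two_of_colonElem {R M : Type*} [CommRing R] [AddCommGroup M] [Module R M]
    {𝔭 : Ideal R} [𝔭.IsPrime] (hS : SerreCondition (R ⧸ 𝔭) 2) {N : Submodule R M}
    (hsat : IsSaturatedAt 𝔭 N) {x : M} (hx : colonElem N x = 𝔭) {y : M}
    (hy : (colonElem (N ⊔ Submodule.span R {x}) y).IsPrime)
    (hle : 𝔭 ≤ colonElem (N ⊔ Submodule.span R {x}) y) :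
    ((colonElem (N ⊔ Submodule.span R {x}) y).map (Ideal.Quotient.mk 𝔭)).height < 2 := by
  set 𝔮 := colonElem (N ⊔ Submodule.span R {x}) y with h𝔮
  by_contra! hht
  have hker : RingHom.ker (Ideal.Quotient.mk 𝔭) ≤ 𝔮 := by rwa [Ideal.mk_ker]
  have hQ : (𝔮.map (Ideal.Quotient.mk 𝔭)).IsPrime :=
    Ideal.map_isPrime_of_surjective Ideal.Quotient.mk_surjective hker
  have hmem : ∀ r, Ideal.Quotient.mk 𝔭 r ∈ 𝔮.map (Ideal.Quotient.mk 𝔭) ↔ r ∈ 𝔮 := by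
    intro r
    rw [← Ideal.mem_comap, Ideal.comap_map_of_surjective _ Ideal.Quotient.mk_surjective,
      ← RingHom.ker_eq_comap_bot, sup_eq_left.2 hker]
  obtain ⟨a', ha', b', hb', ha0, hab⟩ := hS.exists_pair _ hht
  obtain ⟨a, rfl⟩ := Ideal.Quotient.mk_surjective a'
  obtain ⟨b, rfl⟩ := Ideal.Quotient.mk_surjective b'
  rw [hmem] at ha' hb'
  have ha : a ∉ 𝔭 := fun h => ha0 (Ideal.Quotient.eq_zero_iff_mem.2 h)
  have hdec : ∀ r ∈ 𝔮, ∃ n ∈ N, ∃ s : R, r • y = n + s • x := by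
    intro r hr
    obtain ⟨n, hn, w, hw, h⟩ := Submodule.mem_sup.1 (mem_colonElem.1 hr)
    obtain ⟨s, rfl⟩ := Submodule.mem_span_singleton.1 hw
    exact ⟨n, hn, s, h.symm⟩
  obtain ⟨n, hn, s, hs⟩ := hdec a ha'
  obtain ⟨n', hn', s', hs'⟩ := hdec b hb'
  have h1 : b * s - a * s' ∈ 𝔭 := by
    rw [← hx, mem_colonElem]
    have : (b * s - a * s') • x = a • n' - b • n := by
      have h2 : b • a • y = a • b • y := smul_comm b a y
      rw [hs, hs', smul_add, smul_add, smul_smul, smul_smul] at h2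
      rw [sub_smul, sub_eq_sub_iff_add_eq_add, add_comm, h2, add_comm]
    rw [this]
    exact N.sub_mem (N.smul_mem _ hn') (N.smul_mem _ hn)
  obtain ⟨w', hw', v', hv'⟩ := hab (Ideal.Quotient.mk 𝔭 s) ⟨Ideal.Quotient.mk 𝔭 s', by
    rw [← map_mul, ← map_mul]
    exact Ideal.Quotient.eq.2 h1⟩
  obtain ⟨w, rfl⟩ := Ideal.Quotient.mk_surjective w'
  obtain ⟨v, rfl⟩ := Ideal.Quotient.mk_surjective v'
  rw [hmem] at hw'
  rw [← map_mul, ← map_mul, Ideal.Quotient.eq] at hv'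
  refine hw' (mem_colonElem.2 ?_)
  have h2 : w • y - v • x ∈ N := by
    refine hsat a ha _ ?_
    have h3 : a • (w • y - v • x) = w • n + (w * s - a * v) • x := by
      rw [smul_sub, smul_comm a w, hs, smul_add, sub_smul, smul_smul, smul_smul, add_sub_assoc]
    rw [h3]
    rw [← hx, mem_colonElem] at hv'
    exact N.add_mem (N.smul_mem _ hn) hv'
  rw [← sub_add_cancel (w • y) (v • x)]
  exact Submodule.add_mem_sup h2 (Submodule.mem_span_singleton.2 ⟨v, rfl⟩)

end SerreTwo

/-! ### Hilbert coefficients -/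

section HilbertCoeffs

variable {A R M : Type*} [CommRing A] [CommRing R] [AddCommGroup M] [Module A M] [Module R M]
  {ℳ : ℤ → Submodule A M}

theorem isHilbertCoeffs_iff (hℳ : ∀ n, Module.length A (ℳ n) ≠ ⊤) {s : ℕ}
    (hdim : Module.supportDim R M = (s : WithBot ℕ∞)) {e : Fin s → ℤ} :
    IsHilbertCoeffs R ℳ e ↔ ∀ᶠ n : ℕ in atTop, ((Module.length A (ℳ n)).toNat : ℤ) =
      ∑ i : Fin s, (-1) ^ (i : ℕ) * e i *
        ((n + (s - 1 - (i : ℕ))).choose (s - 1 - (i : ℕ)) : ℤ) := by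
  constructor
  · rintro ⟨-, h⟩
    filter_upwards [h] with n ⟨l, hl, hl'⟩
    rw [hl, ENat.toNat_natCast, hl']
  · intro h
    refine ⟨hdim, ?_⟩
    filter_upwards [h] with n hn
    exact ⟨_, (ENat.natCast_toNat (hℳ n)).symm, hn⟩

/-- Existence and uniqueness hold because the binomial functions of degree less than `s` form a
basis of the integer-valued polynomial functions of degree less than `s`. -/
theorem existsUnique_isHilbertCoeffs (hℳ : ∀ n, Module.length A (ℳ n) ≠ ⊤) {s : ℕ}
    (hdim : Module.supportDim R M = (s : WithBot ℕ∞))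
    (hpoly : IsNumPoly s fun n => ((Module.length A (ℳ n)).toNat : ℤ)) :
    ∃! e : Fin s → ℤ, IsHilbertCoeffs R ℳ e := by
  obtain ⟨c, hc⟩ := hpoly.exists_binomFun
  refine ⟨fun i => (-1) ^ (i : ℕ) * c (s - 1 - i), ?_, fun e he => ?_⟩
  · refine (isHilbertCoeffs_iff hℳ hdim).2
      ((eventually_eq_sum_binomFun_iff (f := fun n => ((Module.length A (ℳ n)).toNat : ℤ))
        (c := c) fun i => ?_).2 hc)
    rw [← mul_assoc, ← pow_add, Even.neg_one_pow ⟨_, rfl⟩, one_mul]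
  · have h1 := (eventually_eq_sum_binomFun_iff (f := fun n => ((Module.length A (ℳ n)).toNat : ℤ))
      (hilbertCoeffsRev_apply e)).1 ((isHilbertCoeffs_iff hℳ hdim).1 he)
    have h2 : ∑ j ∈ Finset.range s, (hilbertCoeffsRev e j - c j) • binomFun j =ᶠ[atTop] 0 := by
      simp only [sub_smul, Finset.sum_sub_distrib]
      filter_upwards [hc, h1] with n h3 h4
      rw [Pi.sub_apply, ← h3, ← h4, sub_self, Pi.zero_apply]
    funext i
    have h3 := eq_zero_of_sum_binomFun_eventually_eq_zero h2 (s - 1 - i) (by have := i.2; omega)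
    rw [← sub_eq_zero.1 h3, hilbertCoeffsRev_apply, ← mul_assoc, ← pow_add,
      Even.neg_one_pow ⟨_, rfl⟩, one_mul]

/-- Comparison of the two leading coefficients in `H(n) = l h(n - t) + τ(n)`, where `τ` has degree
one less than `H` and `h`. -/
theorem leading_coeffs_eq {k : ℕ} {H h τ : ℤ → ℤ} {e₀ e₁ ε₀ ε₁ c t l : ℤ}
    (hH : ∀ᶠ n in atTop, (bwdDiff ^ k) H n = e₀ * (n + 1) - e₁)
    (hh : ∀ᶠ n in atTop, (bwdDiff ^ k) h n = ε₀ * (n + 1) - ε₁)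
    (hτ : ∀ᶠ n in atTop, (bwdDiff ^ k) τ n = c)
    (heq : H = (l • fun n => h (n - t)) + τ) :
    e₀ = l * ε₀ ∧ e₁ = t * e₀ + l * ε₁ - c := by
  have key : ∀ᶠ n in atTop, e₀ * (n + 1) - e₁ = l * (ε₀ * (n - t + 1) - ε₁) + c := by
    filter_upwards [hH, (tendsto_sub_const_atTop t).eventually hh, hτ] with n h1 h2 h3
    rw [← h1, heq, map_add, map_smul, bwdDiff_pow_shift, Pi.add_apply, Pi.smul_apply, h2, h3,
      smul_eq_mul]
  obtain ⟨n, h1, h2⟩ := (key.and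
    ((tendsto_atTop_add_const_right atTop (1 : ℤ) tendsto_id).eventually key)).exists
  simp only [id] at h2
  have h3 : e₀ = l * ε₀ := by linear_combination h2 - h1
  exact ⟨h3, by linear_combination -h1 + (n + 1 - t) * h3⟩

end HilbertCoeffs

/-! ### The quotient by the nilradical -/

section Nilradical

variable {R : Type*} [CommRing R] (𝒜 : ℕ → AddSubgroup R) [GradedRing 𝒜]
  [IsArtinianRing (𝒜 0)] [IsLocalRing (𝒜 0)]

theorem isNilpotent_of_mem_map_maximalIdeal :
    ∀ p ∈ (IsLocalRing.maximalIdeal (𝒜 0)).map (algebraMap (𝒜 0) R), IsNilpotent p := by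
  have h : (IsLocalRing.maximalIdeal (𝒜 0)).map (algebraMap (𝒜 0) R) ≤ nilradical R := by
    rw [Ideal.map_le_iff_le_comap]
    intro a ha
    have h1 : IsNilpotent a := Ring.KrullDimLE.isNilpotent_iff_mem_nonunits.2 ha
    exact mem_nilradical.2 (h1.map (algebraMap (𝒜 0) R))
  exact fun p hp => mem_nilradical.1 (h hp)

omit [IsArtinianRing (𝒜 0)] in
theorem image_maximalIdeal_subset :
    (algebraMap (𝒜 0) R) '' (IsLocalRing.maximalIdeal (𝒜 0)) ⊆ ringGrading 𝒜 0 := by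
  rintro _ ⟨a, -, rfl⟩
  exact a.2

omit [IsArtinianRing (𝒜 0)] in
theorem isHomogeneous_map_maximalIdeal :
    ((IsLocalRing.maximalIdeal (𝒜 0)).map (algebraMap (𝒜 0) R)).IsHomogeneous
      (ringGrading 𝒜) :=
  Ideal.homogeneous_span _ _ fun _ hx => ⟨0, image_maximalIdeal_subset 𝒜 hx⟩

omit [IsArtinianRing (𝒜 0)] [IsLocalRing (𝒜 0)] in
theorem finiteType_of_adjoin_eq_top [IsNoetherianRing R]
    (h_std : Algebra.adjoin (𝒜 0) (𝒜 1 : Set R) = ⊤) : Algebra.FiniteType (𝒜 0) R := by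
  have h1 : IsNoetherian (𝒜 0) (ringGrading 𝒜 1) :=
    isNoetherian_component (ringGrading_smul_mem 𝒜)
      (exists_algebraMap_eq_of_mem_ringGrading_zero 𝒜) 1
  obtain ⟨T, hT⟩ := (Submodule.fg_top (ringGrading 𝒜 1)).1 (h1.noetherian ⊤)
  refine ⟨⟨T, top_le_iff.1 ?_⟩⟩
  rw [← h_std, Algebra.adjoin_le_iff]
  intro x hx
  have hx' : x ∈ Submodule.span (𝒜 0) (T : Set R) := hT ▸ (mem_ringGrading_one 𝒜).2 hx
  exact Algebra.span_le_adjoin _ _ hx'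

variable {𝒜} {𝔭 : Ideal R}
  (h𝔭 : 𝔭 = (IsLocalRing.maximalIdeal (𝒜 0)).map (algebraMap (𝒜 0) R))

include h𝔭

omit [IsArtinianRing (𝒜 0)] in
/-- `R / 𝔪R` is an algebra over the residue field of `R₀`. -/
theorem exists_residueField_algebra :
    ∃ _ : Algebra (IsLocalRing.ResidueField (𝒜 0)) (R ⧸ 𝔭),
      IsScalarTower (𝒜 0) (IsLocalRing.ResidueField (𝒜 0)) (R ⧸ 𝔭) := by
  have h : ∀ a ∈ IsLocalRing.maximalIdeal (𝒜 0), algebraMap (𝒜 0) (R ⧸ 𝔭) a = 0 := by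
    intro a ha
    rw [IsScalarTower.algebraMap_apply (𝒜 0) R (R ⧸ 𝔭)]
    refine Ideal.Quotient.eq_zero_iff_mem.2 ?_
    rw [h𝔭]
    exact Ideal.mem_map_of_mem _ ha
  let f : IsLocalRing.ResidueField (𝒜 0) →+* R ⧸ 𝔭 :=
    Ideal.Quotient.lift (IsLocalRing.maximalIdeal (𝒜 0)) (algebraMap (𝒜 0) (R ⧸ 𝔭)) h
  let _ := f.toAlgebra
  exact ⟨f.toAlgebra, IsScalarTower.of_algebraMap_eq fun a => rfl⟩

theorem ringKrullDim_quotient_eq_of_eq_map : ringKrullDim (R ⧸ 𝔭) = ringKrullDim R := by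
  refine le_antisymm (ringKrullDim_quotient_le 𝔭) ?_
  rw [ringKrullDim_quotient]
  have hall : ∀ P : PrimeSpectrum R, P ∈ PrimeSpectrum.zeroLocus (𝔭 : Set R) := fun P p hp => by
    obtain ⟨n, hn⟩ := isNilpotent_of_mem_map_maximalIdeal 𝒜 p (h𝔭 ▸ hp)
    exact P.2.mem_of_pow_mem n (hn ▸ P.asIdeal.zero_mem)
  exact Order.krullDim_le_of_strictMono (fun P => ⟨P, hall P⟩) fun _ _ h => h

variable [IsNoetherianRing R] [𝔭.IsPrime]
  (h_std : Algebra.adjoin (𝒜 0) (𝒜 1 : Set R) = ⊤) {d : ℕ} (hd : d ≤ ringKrullDim (R ⧸ 𝔭))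

include h_std hd

/-- The Hilbert function of `R / 𝔭` has degree at least `dim R / 𝔭 - 1`. -/
theorem not_isNumPoly_quotHilb {s : ℕ} (hs : s + 1 ≤ d) :
    ¬ IsNumPoly s (quotHilb (ringGrading 𝒜) 𝔭) := by
  intro hpoly
  obtain ⟨_, _⟩ := exists_residueField_algebra h𝔭
  have := finiteType_of_adjoin_eq_top 𝒜 h_std
  have : Algebra.FiniteType (𝒜 0) (R ⧸ 𝔭) :=
    Algebra.FiniteType.of_surjective (Ideal.Quotient.mkₐ (𝒜 0) 𝔭) Ideal.Quotient.mk_surjective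
  have : Algebra.FiniteType (IsLocalRing.ResidueField (𝒜 0)) (R ⧸ 𝔭) :=
    Algebra.FiniteType.of_restrictScalars_finiteType (𝒜 0) _ _
  obtain ⟨m, g, hm, hg, -⟩ := exists_mvPolynomial_isIntegral_of_le_ringKrullDim
    (IsLocalRing.ResidueField (𝒜 0)) (R ⧸ 𝔭) hd
  exact not_quotHilb_le_of_isNumPoly 𝒜 𝔭 (g.restrictScalars (𝒜 0)) hg
    (by rw [Fintype.card_fin]; omega) hpoly fun n => le_rfl

/-- If `𝔮 / 𝔭` has height one, then the Hilbert function of `R / 𝔮` has degree at least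
`dim R / 𝔭 - 2`. -/
theorem not_quotHilb_le_of_height_lt_two {𝔮 : Ideal R} [𝔮.IsPrime] (hlt : 𝔭 < 𝔮)
    (hht : (𝔮.map (Ideal.Quotient.mk 𝔭)).height < 2) {s : ℕ} (hs : s + 2 ≤ d) {f : ℤ → ℤ}
    (hf : IsNumPoly s f) : ¬ ∀ n : ℕ, quotHilb (ringGrading 𝒜) 𝔮 n ≤ f n := by
  obtain ⟨_, _⟩ := exists_residueField_algebra h𝔭
  have := finiteType_of_adjoin_eq_top 𝒜 h_std
  have : Algebra.FiniteType (𝒜 0) (R ⧸ 𝔭) :=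
    Algebra.FiniteType.of_surjective (Ideal.Quotient.mkₐ (𝒜 0) 𝔭) Ideal.Quotient.mk_surjective
  have : Algebra.FiniteType (IsLocalRing.ResidueField (𝒜 0)) (R ⧸ 𝔭) :=
    Algebra.FiniteType.of_restrictScalars_finiteType (𝒜 0) _ _
  have hQ : (𝔮.map (Ideal.Quotient.mk 𝔭)).IsPrime :=
    Ideal.map_isPrime_of_surjective Ideal.Quotient.mk_surjective
      (by rw [Ideal.mk_ker]; exact hlt.le)
  have hQ0 : 𝔮.map (Ideal.Quotient.mk 𝔭) ≠ ⊥ := by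
    intro h
    rw [Ideal.map_eq_bot_iff_le_ker, Ideal.mk_ker] at h
    exact not_le_of_gt hlt h
  obtain ⟨m, i, φ, hm, hφ⟩ := exists_mvPolynomial_injective_of_height_le_one
    (IsLocalRing.ResidueField (𝒜 0)) (R ⧸ 𝔭) hd (𝔮.map (Ideal.Quotient.mk 𝔭)) hQ0
    (Order.le_of_lt_add_one hht)
  -- `{j // j ≠ i}` has `m - 1 ≥ d - 1` elements.
  let e : ((R ⧸ 𝔭) ⧸ 𝔮.map (Ideal.Quotient.mk 𝔭)) ≃ₐ[𝒜 0] R ⧸ 𝔮 :=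
    DoubleQuot.quotQuotEquivQuotOfLEₐ (𝒜 0) hlt.le
  refine not_quotHilb_le_of_isNumPoly 𝒜 𝔮 (e.toAlgHom.comp (φ.restrictScalars (𝒜 0)))
    (e.injective.comp hφ) ?_ hf
  rw [Fintype.card_subtype_compl, Fintype.card_fin, Fintype.card_subtype_eq]
  omega

end Nilradical

/-! ### The Hilbert function of an unmixed module -/

section Unmixed

variable {R : Type*} [CommRing R] {𝒜 : ℕ → AddSubgroup R} [GradedRing 𝒜]
  [IsArtinianRing (𝒜 0)] [IsLocalRing (𝒜 0)] {𝔭 : Ideal R}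
  (h𝔭 : 𝔭 = (IsLocalRing.maximalIdeal (𝒜 0)).map (algebraMap (𝒜 0) R))

include h𝔭

theorem le_of_isPrime_of_eq_map {P : Ideal R} (hP : P.IsPrime) : 𝔭 ≤ P := fun p hp => by
  obtain ⟨n, hn⟩ := isNilpotent_of_mem_map_maximalIdeal 𝒜 p (h𝔭 ▸ hp)
  exact hP.mem_of_pow_mem n (hn ▸ P.zero_mem)

theorem ringKrullDim_quotient_le_sup (I : Ideal R) :
    ringKrullDim (R ⧸ I) ≤ ringKrullDim (R ⧸ I ⊔ 𝔭) := by
  rw [ringKrullDim_quotient, ringKrullDim_quotient]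
  have hall : ∀ P : PrimeSpectrum.zeroLocus (I : Set R),
      (P : PrimeSpectrum R) ∈ PrimeSpectrum.zeroLocus ((I ⊔ 𝔭 : Ideal R) : Set R) := fun P =>
    sup_le P.2 (le_of_isPrime_of_eq_map h𝔭 P.1.2)
  exact Order.krullDim_le_of_strictMono (fun P => ⟨P, hall P⟩) fun _ _ h => h

variable [h𝔭' : 𝔭.IsPrime]

omit [IsArtinianRing (𝒜 0)] [IsLocalRing (𝒜 0)] h𝔭 in
theorem ringKrullDim_quotient_add_one_le {d : ℕ} (hd : ringKrullDim (R ⧸ 𝔭) = d) {I : Ideal R}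
    (hle : 𝔭 ≤ I) {a : R} (ha : a ∈ I) (ha𝔭 : a ∉ 𝔭) : ringKrullDim (R ⧸ I) + 1 ≤ d := by
  rw [← hd]
  refine ringKrullDim_succ_le_of_surjective (Ideal.Quotient.factor hle)
    (Ideal.Quotient.factor_surjective _) (r := Ideal.Quotient.mk 𝔭 a)
    (mem_nonZeroDivisors_of_ne_zero fun h => ha𝔭 (Ideal.Quotient.eq_zero_iff_mem.1 h)) ?_
  rw [Ideal.Quotient.factor_mk, Ideal.Quotient.eq_zero_iff_mem]
  exact ha

variable {M : Type*} [AddCommGroup M] [Module R M]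

/-- A module of maximal dimension without embedded primes is torsion-free over `R ∖ 𝔭`, where `𝔭` is
the only minimal prime of `R`. -/
theorem isSaturatedAt_bot [IsNoetherianRing R] [Module.Finite R M] {d : ℕ}
    (hd : ringKrullDim (R ⧸ 𝔭) = d) (hdM : Module.supportDim R M = d)
    (h_ass : associatedPrimes R M = (Module.annihilator R M).minimalPrimes) :
    IsSaturatedAt 𝔭 (⊥ : Submodule R M) := by
  intro s hs m hm
  by_contra hm0
  obtain ⟨P, hP, hle⟩ := exists_le_isAssociatedPrime_of_isNoetherianRing R m hm0
  have hmin : P ∈ (Module.annihilator R M).minimalPrimes := h_ass ▸ hP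
  have hann : Module.annihilator R M ≤ 𝔭 := by
    by_contra hc
    obtain ⟨a, ha, ha𝔭⟩ := Set.not_subset.1 hc
    rw [Module.supportDim_eq_ringKrullDim_quotient_annihilator] at hdM
    have h1 := ringKrullDim_quotient_add_one_le hd le_sup_right
      (show a ∈ Module.annihilator R M ⊔ 𝔭 from Ideal.mem_sup_left ha) ha𝔭
    have h2 := ringKrullDim_quotient_le_sup h𝔭 (Module.annihilator R M)
    rw [hdM] at h2
    have h3 : ((d + 1 : ℕ) : WithBot ℕ∞) ≤ (d : ℕ) := by
      rw [Nat.cast_succ]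
      exact (add_le_add_left h2 1).trans h1
    have h4 : d + 1 ≤ d := by exact_mod_cast h3
    omega
  exact hs (hmin.2 ⟨h𝔭', hann⟩ (le_of_isPrime_of_eq_map h𝔭 hmin.1.1)
    (hle (Submodule.mem_colon_singleton.2 hm)))

variable [Module (𝒜 0) M] [IsScalarTower (𝒜 0) R M] [IsNoetherianRing R] [IsNoetherian R M]
  {ℳ : ℤ → Submodule (𝒜 0) M} [Decomposition ℳ]
  (hsm : ∀ i j, ∀ a ∈ ringGrading 𝒜 i, ∀ x ∈ ℳ j, a • x ∈ ℳ (i + j))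
  (h_std : Algebra.adjoin (𝒜 0) (𝒜 1 : Set R) = ⊤)

include hsm h_std

/-- The torsion module `N^sat / N` has dimension less than `dim R / 𝔭`. -/
theorem isNumPoly_quotHilb_sub_saturationAt {s : ℕ} (hd : ringKrullDim (R ⧸ 𝔭) = (s + 1 : ℕ))
    {N : Submodule R M} (hN : N.IsHomogeneous ℳ) :
    IsNumPoly s (quotHilb ℳ N - quotHilb ℳ (saturationAt 𝔭 N)) := by
  have hnil := h𝔭 ▸ isNilpotent_of_mem_map_maximalIdeal 𝒜
  refine isNumPoly_quotHilb_sub hsm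
    (length_component_ne_top hsm (exists_algebraMap_eq_of_mem_ringGrading_zero 𝒜))
    (length_ringGrading_ne_top 𝒜) hN (isHomogeneous_saturationAt hsm hnil hN)
    (le_saturationAt N) s fun 𝔮 h𝔮 hhom hann => ?_
  obtain ⟨a, ha, hann'⟩ := exists_smul_le_of_fg (𝔭 := 𝔭) N
  have h1 := ringKrullDim_quotient_add_one_le hd (le_of_isPrime_of_eq_map h𝔭 h𝔮)
    (hann a hann') ha
  refine isNumPoly_quotHilb_of_ringKrullDim_le 𝒜 h_std s 𝔮 h𝔮 hhom ?_
  rw [Nat.cast_succ] at h1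
  exact ENat.WithBot.add_le_add_one_right_iff.1 h1

omit hsm in
theorem isNumPoly_quotHilb_prime {d : ℕ} (hd : ringKrullDim (R ⧸ 𝔭) = d) :
    IsNumPoly d (quotHilb (ringGrading 𝒜) 𝔭) :=
  isNumPoly_quotHilb_of_ringKrullDim_le 𝒜 h_std d 𝔭 h𝔭'
    (h𝔭 ▸ isHomogeneous_map_maximalIdeal 𝒜) hd.le

omit h𝔭' in
theorem isNumPoly_quotHilb_bot {d : ℕ} (hd : ringKrullDim (R ⧸ 𝔭) = d) :
    IsNumPoly d (quotHilb ℳ (⊥ : Submodule R M)) := by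
  have h1 := isNumPoly_quotHilb_sub hsm
    (length_component_ne_top hsm (exists_algebraMap_eq_of_mem_ringGrading_zero 𝒜))
    (length_ringGrading_ne_top 𝒜) (isHomogeneous_bot (R := R) (ℳ := ℳ)) isHomogeneous_top bot_le d
    fun 𝔮 h𝔮 hhom _ => isNumPoly_quotHilb_of_ringKrullDim_le 𝒜 h_std d 𝔮 h𝔮 hhom
      ((ringKrullDim_le_of_surjective (Ideal.Quotient.factor (le_of_isPrime_of_eq_map h𝔭 h𝔮))
        (Ideal.Quotient.factor_surjective _)).trans hd.le)
  refine h1.congr (Eventually.of_forall fun n => ?_)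
  rw [Pi.sub_apply, quotHilb_top, sub_zero]

/-- Under `(S₂)`, the torsion of `M / (N + R x)`, with `M / N` torsion-free and `R x ≅ R / 𝔭` modulo
`N`, vanishes as soon as its dimension is at most `dim R / 𝔭 - 2`. -/
theorem saturationAt_sup_span_eq (hS : SerreCondition (R ⧸ 𝔭) 2) {k : ℕ}
    (hd : ringKrullDim (R ⧸ 𝔭) = (k + 2 : ℕ)) {N : Submodule R M} (hN : N.IsHomogeneous ℳ)
    (hsat : IsSaturatedAt 𝔭 N) {t : ℤ} {x : M} (hxt : x ∈ ℳ t) (hx : colonElem N x = 𝔭)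
    (hpoly : IsNumPoly k (quotHilb ℳ (N ⊔ Submodule.span R {x}) -
      quotHilb ℳ (saturationAt 𝔭 (N ⊔ Submodule.span R {x})))) :
    saturationAt 𝔭 (N ⊔ Submodule.span R {x}) = N ⊔ Submodule.span R {x} := by
  have hnil := h𝔭 ▸ isNilpotent_of_mem_map_maximalIdeal 𝒜
  have hℳ := length_component_ne_top hsm (exists_algebraMap_eq_of_mem_ringGrading_zero 𝒜)
  set N' := N ⊔ Submodule.span R {x} with hN'
  have hhom : N'.IsHomogeneous ℳ := isHomogeneous_sup_span hsm hN hxt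
  refine le_antisymm ?_ (le_saturationAt N')
  by_contra hnot
  -- `R / (N' : y)` embeds into the torsion module up to a shift, which bounds its Hilbert function.
  obtain ⟨b, y, hyb, hy, -, hprime⟩ := exists_isPrime_colonElem hsm hhom
    (isHomogeneous_saturationAt hsm hnil hhom) hnot
  have hle := le_of_isPrime_of_eq_map h𝔭 hprime
  obtain ⟨a, ha, hay⟩ := mem_saturationAt.1 hy
  have hlt : 𝔭 < colonElem N' y := lt_of_le_of_ne hle fun h => ha (h ▸ hay)
  refine not_quotHilb_le_of_height_lt_two h𝔭 h_std hd.ge hlt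
    (height_map_lt_two_of_colonElem hS hsat hx hprime hle) le_rfl (hpoly.shift (-b)) fun n => ?_
  have h1 := quotHilb_sup_span hsm hℳ (length_ringGrading_ne_top 𝒜) hhom hyb (n - -b)
  have h2 : N' ⊔ Submodule.span R {y} ≤ saturationAt 𝔭 N' :=
    sup_le (le_saturationAt N') ((Submodule.span_singleton_le_iff_mem _ _).2 hy)
  have h3 := quotHilb_antitone hℳ h2 (n - -b)
  rw [show (n : ℤ) - -b - b = n by ring] at h1
  rw [Pi.sub_apply, h1]
  linarith

omit [IsArtinianRing (𝒜 0)] [IsLocalRing (𝒜 0)] h𝔭 [𝔭.IsPrime] [IsNoetherian R M]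
  [IsNoetherianRing R] h_std in
theorem hasShiftFiltration_of_chain {t : ℤ} {r : ℕ} {L : ℕ → Submodule R M} {x : ℕ → M}
    (h0 : L 0 = ⊥) (hr : L r = ⊤) (hL : ∀ i, (L i).IsHomogeneous ℳ)
    (hx : ∀ i < r, x i ∈ ℳ t ∧ colonElem (L i) (x i) = 𝔭 ∧
      L (i + 1) = L i ⊔ Submodule.span R {x i}) :
    HasShiftFiltration (R := R) ℳ (quotGrading (ringGrading 𝒜) 𝔭) t := by
  refine ⟨r, L, fun i _ => hL i, h0, hr, fun i hi => ?_⟩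
  obtain ⟨hxt, hcolon, hsucc⟩ := hx i hi
  subst hcolon
  rw [hsucc]
  refine ⟨colonElemMap (L i) (x i), Submodule.factor le_sup_left, fun n s hs => ?_,
    isGradedHom_factor _, colonElemMap_injective _ _, colonElemMap_exact _ _,
    Submodule.factor_surjective _⟩
  have := colonElemMap_mem hsm (L i) hxt (n + -t) s hs
  rwa [neg_add_cancel_right] at this

omit [𝔭.IsPrime] h_std in
theorem quotHilb_bot_of_hasShiftFiltration {t : ℤ}
    (h : HasShiftFiltration (R := R) ℳ (quotGrading (ringGrading 𝒜) 𝔭) t) :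
    ∃ r : ℕ, quotHilb ℳ (⊥ : Submodule R M) =
      ((r : ℤ) • fun n => quotHilb (ringGrading 𝒜) 𝔭 (n - t)) + 0 := by
  obtain ⟨r, L, hL, h0, hr, hstep⟩ := h
  refine ⟨r, ?_⟩
  have key : ∀ i ≤ r, ∀ n, quotHilb ℳ (⊥ : Submodule R M) n =
      i * quotHilb (ringGrading 𝒜) 𝔭 (n - t) + quotHilb ℳ (L i) n := by
    intro i
    induction i with
    | zero => simp [h0]
    | succ i ih =>
      intro hi n
      obtain ⟨f, g, hf, hg, hinj, hexact, hsurj⟩ := hstep i hi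
      rw [ih (by omega) n, quotHilb_eq_add_of_exact
        (length_component_ne_top hsm (exists_algebraMap_eq_of_mem_ringGrading_zero 𝒜))
        (length_ringGrading_ne_top 𝒜) (h𝔭 ▸ isHomogeneous_map_maximalIdeal 𝒜) (hL i (by omega))
        (hL (i + 1) hi) f g t (fun n s hs => hf (n + t) s (by
          rwa [shiftGrading, add_neg_cancel_right])) hg hinj hexact hsurj n]
      push_cast
      ring
  funext n
  rw [key r le_rfl n, hr, quotHilb_top]
  simp

end Unmixed

/-! ### Hilbert coefficients of an unmixed module -/

theorem theorem1 {R : Type*} [CommRing R] [IsNoetherianRing R]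
    (𝒜 : ℕ → AddSubgroup R) [GradedRing 𝒜]
    -- `R = R_0[R_1]` is standard graded, and `R_0` is an Artinian local ring
    (h_std : Algebra.adjoin (𝒜 0) (𝒜 1 : Set R) = ⊤)
    [IsArtinianRing (𝒜 0)] [IsLocalRing (𝒜 0)]
    (d : ℕ) (hd : 2 ≤ d) (h_dim : ringKrullDim R = (d : WithBot ℕ∞))
    -- `𝔭 = 𝔪R` is prime
    (𝔭 : Ideal R) (h𝔭 : 𝔭 = (IsLocalRing.maximalIdeal (𝒜 0)).map (algebraMap (𝒜 0) R))
    [𝔭.IsPrime]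
    -- `M` is a finitely generated graded `R`-module
    {M : Type*} [AddCommGroup M] [Module R M] [Module.Finite R M]
    [Module (𝒜 0) M] [IsScalarTower (𝒜 0) R M]
    (ℳ : ℤ → Submodule (𝒜 0) M) [DirectSum.Decomposition ℳ]
    (h_smul : ∀ (i : ℕ) (j : ℤ), ∀ a ∈ 𝒜 i, ∀ x ∈ ℳ j, a • x ∈ ℳ ((i : ℤ) + j))
    -- `M` is generated in the single degree `t`
    (t : ℤ) (h_gen : Submodule.span R (ℳ t : Set M) = ⊤)
    (h_dimM : Module.supportDim R M = (d : WithBot ℕ∞))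
    -- `Ass M = Min M`
    (h_ass : associatedPrimes R M = (Module.annihilator R M).minimalPrimes) :
    -- the Hilbert coefficients of `M` and of `R/𝔭` exist and are unique,
    (∃! e : Fin d → ℤ, IsHilbertCoeffs R ℳ e) ∧
    (∃! ε : Fin d → ℤ, IsHilbertCoeffs R (quotGrading (ringGrading 𝒜) 𝔭) ε) ∧
    -- and with `ℓ` the (finite) length of `M_𝔭`:
    ∃ l : ℕ, Module.length (Localization.AtPrime 𝔭) (LocalizedModule 𝔭.primeCompl M) = (l : ℕ∞) ∧
      ∀ e ε : Fin d → ℤ, IsHilbertCoeffs R ℳ e →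
        IsHilbertCoeffs R (quotGrading (ringGrading 𝒜) 𝔭) ε →
        -- (a)
        (e ⟨0, by omega⟩ = (l : ℤ) * ε ⟨0, by omega⟩ ∧
          e ⟨1, by omega⟩ ≤ t * e ⟨0, by omega⟩ + (l : ℤ) * ε ⟨1, by omega⟩) ∧
        -- (b), (ii) implies (i)
        (HasShiftFiltration (R := R) ℳ (quotGrading (ringGrading 𝒜) 𝔭) t →
          e ⟨1, by omega⟩ = t * e ⟨0, by omega⟩ + (l : ℤ) * ε ⟨1, by omega⟩) ∧
        -- (b), (i) implies (ii) under `(S_2)`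
        (SerreCondition (R ⧸ 𝔭) 2 →
          e ⟨1, by omega⟩ = t * e ⟨0, by omega⟩ + (l : ℤ) * ε ⟨1, by omega⟩ →
          HasShiftFiltration (R := R) ℳ (quotGrading (ringGrading 𝒜) 𝔭) t) := by
  obtain ⟨k, rfl⟩ : ∃ k, d = k + 2 := ⟨d - 2, by omega⟩
  have hsm : ∀ i j, ∀ a ∈ ringGrading 𝒜 i, ∀ x ∈ ℳ j, a • x ∈ ℳ (i + j) := by
    intro i j a ha x hx
    rcases lt_or_ge i 0 with hi | hi
    · rw [ringGrading_of_neg 𝒜 hi, Submodule.mem_bot] at ha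
      rw [ha, zero_smul]
      exact zero_mem _
    · obtain ⟨i, rfl⟩ := Int.eq_ofNat_of_zero_le hi
      exact h_smul i j a ha x hx
  have hM := isNoetherian_of_isNoetherianRing_of_finite R M
  have hdp : ringKrullDim (R ⧸ 𝔭) = (k + 2 : ℕ) :=
    (ringKrullDim_quotient_eq_of_eq_map h𝔭).trans h_dim
  have hnil := h𝔭 ▸ isNilpotent_of_mem_map_maximalIdeal 𝒜
  have hℳ := length_component_ne_top hsm (exists_algebraMap_eq_of_mem_ringGrading_zero 𝒜)
  have hℛ := length_ringGrading_ne_top 𝒜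
  have hS : ∀ n, Module.length (𝒜 0) (quotGrading (ringGrading 𝒜) 𝔭 n) ≠ ⊤ := fun n =>
    ne_top_of_le_ne_top (hℛ n) (length_quotGrading_le _ 𝔭 n)
  have hdS : Module.supportDim R (R ⧸ 𝔭) = (k + 2 : ℕ) := by
    rw [Module.supportDim_quotient_eq_ringKrullDim, hdp]
  have hMbot : (fun n => ((Module.length (𝒜 0) (ℳ n)).toNat : ℤ)) =
      quotHilb ℳ (⊥ : Submodule R M) := by
    funext n
    rw [quotHilb, length_quotGrading_bot]
  refine ⟨existsUnique_isHilbertCoeffs hℳ h_dimM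
      (hMbot ▸ isNumPoly_quotHilb_bot h𝔭 hsm h_std hdp),
    existsUnique_isHilbertCoeffs hS hdS (isNumPoly_quotHilb_prime h𝔭 h_std hdp), ?_⟩
  obtain ⟨r, L, x, h0, hr, hL, hx⟩ := exists_saturated_chain hsm
    (image_maximalIdeal_subset 𝒜) h𝔭 hnil h_gen ⊥ isHomogeneous_bot
    (isSaturatedAt_bot h𝔭 hdp h_dimM h_ass)
  refine ⟨r, length_localizedModule_eq h0 hr (fun i => (hL i).2) fun i hi => (hx i hi).2, ?_⟩
  -- The `i`-th factor of the chain is an extension of a torsion module, with Hilbert function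
  -- `τ i`, by `(R / 𝔭)(-t)`.
  let τ : ℕ → ℤ → ℤ := fun i => quotHilb ℳ (L i ⊔ Submodule.span R {x i}) -
    quotHilb ℳ (saturationAt 𝔭 (L i ⊔ Submodule.span R {x i}))
  have hsum : quotHilb ℳ (⊥ : Submodule R M) =
      ((r : ℤ) • fun n => quotHilb (ringGrading 𝒜) 𝔭 (n - t)) + ∑ i ∈ Finset.range r, τ i := by
    funext n
    have h1 : ∀ i ∈ Finset.range r, quotHilb ℳ (L i) n - quotHilb ℳ (L (i + 1)) n =
        quotHilb (ringGrading 𝒜) 𝔭 (n - t) + τ i n := by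
      intro i hi
      obtain ⟨hxt, hcolon, hsucc⟩ := hx i (Finset.mem_range.1 hi)
      rw [quotHilb_sup_span hsm hℳ hℛ (hL i).1 hxt n, hcolon, hsucc]
      simp only [τ, Pi.sub_apply]
      ring
    have h2 := Finset.sum_range_sub' (fun i => quotHilb ℳ (L i) n) r
    rw [Finset.sum_congr rfl h1, Finset.sum_add_distrib, h0, hr, quotHilb_top, sub_zero] at h2
    rw [← h2]
    simp
  have hτ : ∀ i < r, ∃ c : ℤ, 0 ≤ c ∧ ∀ᶠ n in atTop, (bwdDiff ^ k) (τ i) n = c := fun i hi =>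
    (isNumPoly_quotHilb_sub_saturationAt h𝔭 hsm h_std hdp
      (isHomogeneous_sup_span hsm (hL i).1 (hx i hi).1)).exists_nonneg_const
      (Eventually.of_forall fun n =>
        sub_nonneg.2 (quotHilb_antitone hℳ (le_saturationAt _) n))
  choose! c hc0 hc using hτ
  -- `c i` is the coefficient of degree `k = d - 2` of `τ i`, up to the factor `k!`.
  have hcsum : ∀ᶠ n in atTop, (bwdDiff ^ k) (∑ i ∈ Finset.range r, τ i) n =
      ∑ i ∈ Finset.range r, c i := by
    have h1 : ∀ᶠ n in atTop, ∀ i ∈ Finset.range r, (bwdDiff ^ k) (τ i) n = c i :=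
      (eventually_all_finset _).2 fun i hi => hc i (Finset.mem_range.1 hi)
    filter_upwards [h1] with n hn
    rw [map_sum, Finset.sum_apply]
    exact Finset.sum_congr rfl hn
  intro e ε he hε
  have hH := bwdDiff_pow_eq_of_hilbertPoly
    (f := fun n => ((Module.length (𝒜 0) (ℳ n)).toNat : ℤ))
    ((isHilbertCoeffs_iff hℳ h_dimM).1 he)
  rw [hMbot] at hH
  have hh := bwdDiff_pow_eq_of_hilbertPoly (f := quotHilb (ringGrading 𝒜) 𝔭)
    ((isHilbertCoeffs_iff hS hdS).1 hε)
  obtain ⟨he0, he1⟩ := leading_coeffs_eq hH hh hcsum hsum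
  have hcnonneg : 0 ≤ ∑ i ∈ Finset.range r, c i :=
    Finset.sum_nonneg fun i hi => hc0 i (Finset.mem_range.1 hi)
  change (e 0 = r * ε 0 ∧ e 1 ≤ t * e 0 + r * ε 1) ∧
    (_ → e 1 = t * e 0 + r * ε 1) ∧ (_ → e 1 = t * e 0 + r * ε 1 → _)
  refine ⟨⟨he0, by linarith⟩, fun hfil => ?_, fun hS₂ heq => ?_⟩
  · obtain ⟨r', hr'⟩ := quotHilb_bot_of_hasShiftFiltration h𝔭 hsm hfil
    obtain ⟨he0', he1'⟩ := leading_coeffs_eq hH hh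
      (c := 0) (Eventually.of_forall fun n => by rw [map_zero, Pi.zero_apply]) hr'
    -- The Hilbert function of `R / 𝔭` has degree exactly `k + 1 = d - 1`.
    have hε0 : ε 0 ≠ 0 := by
      intro hε0
      refine not_isNumPoly_quotHilb h𝔭 h_std hdp.ge le_rfl ?_
      rw [IsNumPoly, bwdDiff_pow_succ']
      filter_upwards [hh, (tendsto_sub_const_atTop 1).eventually hh] with n h1 h2
      rw [bwdDiff_apply, h1, h2, hε0]
      ring
    -- Any filtration as in (ii) has `r = l` steps.
    have hrr' : (r : ℤ) = r' := mul_right_cancel₀ hε0 (he0.symm.trans he0')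
    rw [he1', hrr', sub_zero]
  · have hc_zero : ∀ i < r, c i = 0 := fun i hi =>
      (Finset.sum_eq_zero_iff_of_nonneg fun i hi => hc0 i (Finset.mem_range.1 hi)).1
        (by linarith) i (Finset.mem_range.2 hi)
    refine hasShiftFiltration_of_chain (x := x) hsm h0 hr (fun i => (hL i).1) fun i hi => ?_
    obtain ⟨hxt, hcolon, hsucc⟩ := hx i hi
    refine ⟨hxt, hcolon, hsucc.trans ?_⟩
    refine saturationAt_sup_span_eq h𝔭 hsm h_std hS₂ hdp (hL i).1 (hL i).2 hxt hcolon ?_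
    filter_upwards [hc i hi] with n hn
    rw [← hc_zero i hi]
    exact hn
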